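/- **Setting.** Let $M$ be a smooth $n$-manifold without boundary (Hausdorff, second countable), for instance a Riemannian manifold; no metric is needed. Let $J^2(M)=\mathbb R\oplus J^2_{\rm red}(M)$ be the bundle of 2-jets of functions, and write $F_x$ for the fibre over $x$ of a set $F\subset J^2(M)$. A *subequation* is a set $F\subset J^2(M)$ such that (P) $F_x+A\subset F_x$ for all $A\in \mathrm{Sym}^2(T_x^*M)$, $A\ge 0$; (N) $F_x+c\subset F_x$ for all real $c\le 0$; (T) $F=\overline{\mathrm{Int}\,F}$, $F_x=\overline{\mathrm{Int}\,F_x}$ and $\overline{\mathrm{Int}\,F_x}=(\overline{\mathrm{Int}\,F})_x$ for all $x$. Its *dual* is $\widetilde F=-(J^2(M)\setminus \mathrm{Int}\,F)$. For $W\subset M$ open, $F(W)$ is the set of upper semicontinuous $u:W\to[-\infty,\infty)$ such that $J^2_x\psi\in F_x$ whenever $x\in W$, $\psi$ is $C^2$ near $x$, $u\le\psi$ near $x$ and $u(x)=\psi(x)$. For $K\subset M$ compact, $F(K)$ is the set of $u\in \mathrm{USC}(K)$ with values in $[-\infty,\infty)$ and $u|_{\mathrm{Int} K}\in F(\mathrm{Int}\,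 K)$. *Comparison holds for $F$* if for all compact $K\subset M$, $u\in F(K)$, $v\in\widetilde F(K)$: $u+v\le0$ on $\partial K=K\setminus\mathrm{Int}\,K$ implies $u+v\le 0$ on $K$. A function $g$ is *$F$-harmonic* on $W$ if $g\in F(W)$ and $-g\in\widetilde F(W)$. Let $U\subset M$ be a domain (non-empty, connected, open) with compact closure, such that $\overline U$ is a manifold with corners with interior $U$: every point of $\overline U$ has a smooth chart of $M$ in which $\overline U$ and $U$ are given by $x_i\ge0$, respectively $x_i>0$, for $i$ in some (possibly empty) set of coordinates vanishing at the point. Let $\partial U$ be the boundary of $\overline U$ as a manifold with corners in the sense of Joyce, i.e. the set of pairs $(x,\beta)$ of a point $x$ and a local boundary component $\beta$ of $\overline U$ at $x$ (a local choice of a connected component, near $x$, of the stratum of points of depth one), with its natural topology and with the map $i_U:\partial U\to\overline U$, $(x,\beta)\mapsto x$. Assume that $\overline U$ has *embedded corners*: $\partial U$ is a finite disjoint union of open and closed sets on each of which $i_U$ is injective. A function on $\partial U$ is *consistent* if it is constant on the fibres of $i_U$; for $u$ on $\overline U$, $u|_{\partial U}$ means $u\circ i_U$. Let $\phi:\partial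 U\to\mathbb R$ be continuous and consistent. The *Perron family* $\mathscr F(\phi)$, whose members are the *subsolutions* for $(U,\phi)$, consists of all $u\in\mathrm{USC}(\overline U)$ with values in $[-\infty,\infty)$, $u|_U\in F(U)$ and $u|_{\partial U}\le\phi$; the *Perron function* is $u_\phi(x)=\sup\{u(x):u\in\mathscr F(\phi)\}$, $x\in\overline U$. For $r\in\mathbb R$ let $F_r=\{J\in J^2_{\rm red}(M):(r,J)\in F\}$, and let $\vec F_r$ be its asymptotic interior: the set of $J$ that have a neighbourhood $\mathcal N$ in $J^2_{\rm red}(M)$ and a $t_0>0$ with $t\,\mathcal N\subset F_r$ for all $t\ge t_0$. The boundary $\partial U$ is *strictly $F$-convex at* $(x,\beta)\in\partial U$ if for every $r\in\mathbb R$ there is a local defining function $\rho$ (smooth near $x$, negative on $U$, vanishing in $\overline U$ exactly on the sheet $\beta$ of the boundary, with $d\rho\ne0$ there) such that the reduced 2-jet of $\rho$ at $x$ lies in $\vec F_r$. The boundary $\partial U$ is *strictly $(F,\phi)$-convex* if $\partial U=A\sqcup B$ with $A$, $B$ unions of connected components, such that for all $p\in A$ and $\delta>0$ there is a subsolution $u\in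 C^0(\overline U)$ for $(U,\phi)$ with $u(p)\ge\phi(p)-\delta$, and $\partial U$ is strictly $F$-convex at every point of $B$. The same notions are used for $\widetilde F$. **Theorem.** Let $F$ be a subequation on $M$ for which comparison holds, and let $U$ and $\phi$ be as above. Assume that $F(U)$ and $\widetilde F(U)$ each contain a function that is bounded from below. If $\partial U$ is strictly $(F,\phi)$-convex and strictly $(\widetilde F,-\phi)$-convex, then the $F$-Dirichlet problem for $(U,\phi)$ has exactly one solution in $C^0(\overline U)$, that is, there is exactly one $g\in C^0(\overline U)$ which is $F$-harmonic on $U$ and satisfies $g|_{\partial U}=\phi$; and $g=u_\phi$ on $\overline U$. -/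

import Mathlib

open Set Filter Topology
open scoped Manifold ContDiff

noncomputable section

namespace DirichletDuality

/-! ### The bundle of 2-jets of functions on a manifold -/

/-- The model space `ℝⁿ`. -/
abbrev Eu (n : ℕ) : Type := EuclideanSpace ℝ (Fin n)

/-- Bilinear forms on `ℝⁿ`. -/
abbrev BilForm (n : ℕ) : Type := Eu n →L[ℝ] Eu n →L[ℝ] ℝ

-- Mathlib's own instances, recorded here only to shorten the instance search.
set_option synthInstance.maxHeartbeats 400000 in
instance (n : ℕ) : NormedAddCommGroup (BilForm n) := ContinuousLinearMap.toNormedAddCommGroup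

set_option synthInstance.maxHeartbeats 400000 in
instance (n : ℕ) : NormedSpace ℝ (BilForm n) := ContinuousLinearMap.toNormedSpace

instance (n : ℕ) : AddCommGroup (BilForm n) := NormedAddCommGroup.toAddCommGroup

instance (n : ℕ) : AddCommMonoid (BilForm n) := AddCommGroup.toAddCommMonoid

instance (n : ℕ) : Module ℝ (BilForm n) := NormedSpace.toModule

/-- Symmetric bilinear forms on `ℝⁿ`, i.e. `Sym²((ℝⁿ)*)`. -/
def SymForm (n : ℕ) : Submodule ℝ (BilForm n) where
  carrier := {A | ∀ v w, A v w = A w v}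
  add_mem' := by
    intro A B hA hB v w
    simp [hA v w, hB v w]
  zero_mem' := by
    intro v w
    simp
  smul_mem' := by
    intro c A hA v w
    simp [hA v w]

/-- The symmetric part of a bilinear form (the form itself if it is symmetric). -/
def symPart {n : ℕ} (B : BilForm n) : SymForm n :=
  ⟨(1 / 2 : ℝ) • (B + B.flip), by
    intro v w
    change (1 / 2 : ℝ) * (B v w + B w v) = (1 / 2 : ℝ) * (B w v + B v w)
    ring⟩

theorem symPart_of_symm {n : ℕ} (B : SymForm n) : symPart B.1 = B := by
  apply Subtype.ext
  refine ContinuousLinearMap.ext fun v => ContinuousLinearMap.ext fun w => ?_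
  have h : B.1 w v = B.1 v w := B.2 w v
  change (1 / 2 : ℝ) * (B.1 v w + B.1 w v) = B.1 v w
  rw [h]
  ring

/-- Reduced 2-jets at the origin of `ℝⁿ`: pairs (gradient, Hessian). -/
abbrev RedJetFibre (n : ℕ) : Type := (Eu n →L[ℝ] ℝ) × SymForm n

/-- 2-jets at the origin of `ℝⁿ`: triples (value, gradient, Hessian). -/
abbrev JetFibre (n : ℕ) : Type := ℝ × RedJetFibre n

/-- The total space of the bundle `J²(M)`. As for tangent vectors in Mathlib, the fibre at `x` is
written in the preferred chart at `x`; the topology is introduced below. -/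
@[ext]
structure JetBundle (n : ℕ) (M : Type*) where
  base : M
  jet : JetFibre n

/-- The total space of the bundle `J²_red(M)` of reduced 2-jets. -/
@[ext]
structure RedJetBundle (n : ℕ) (M : Type*) where
  base : M
  jet : RedJetFibre n

section Jets

variable {n : ℕ} {M : Type*} [TopologicalSpace M] [ChartedSpace (Eu n) M]

/-- The 2-jet at `x` of a function `u` which is `C²` near `x`. (The second derivative of a `C²`
function is symmetric, so that taking the symmetric part changes nothing.) -/
def jetAt (u : M → ℝ) (x : M) : JetBundle n M where
  base := x
  jet :=
    (u x,
      fderiv ℝ (u ∘ (chartAt (Eu n) x).symm) (chartAt (Eu n) x x),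
      symPart (fderiv ℝ (fderiv ℝ (u ∘ (chartAt (Eu n) x).symm)) (chartAt (Eu n) x x)))

/-- The reduced 2-jet at `x` of a function `u` which is `C²` near `x`. -/
def redJetAt (u : M → ℝ) (x : M) : RedJetBundle n M :=
  ⟨x, (jetAt (n := n) u x).jet.2⟩

/-- The local parametrization of `J²(M)` belonging to a chart `e`: the 2-jet at the point with
coordinates `z` of the function whose Taylor polynomial at `z` in this chart is `j`. -/
def jetParam (e : OpenPartialHomeomorph M (Eu n)) (z : Eu n) (j : JetFibre n) : JetBundle n M :=
  jetAt (fun y => j.1 + j.2.1 (e y - z) + (1 / 2) * j.2.2.1 (e y - z) (e y - z)) (e.symm z)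

/-- The topology of `J²(M)`: the final one for the local parametrizations
`e.target × J² → J²(M)`. -/
instance : TopologicalSpace (JetBundle n M) :=
  ⨆ e : atlas (Eu n) M,
    TopologicalSpace.coinduced
      (fun q : e.1.target × JetFibre n => jetParam e.1 (q.1 : Eu n) q.2) inferInstance

/-- `J²_red(M)` carries the topology of the jets with value zero in `J²(M)`. -/
instance : TopologicalSpace (RedJetBundle n M) :=
  TopologicalSpace.induced (fun J => (⟨J.base, (0, J.jet)⟩ : JetBundle n M)) inferInstance

/-! ### Subequations and subharmonic functions -/

/-- The fibre `F_x` of a subset of the jet bundle. -/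
def fibre (F : Set (JetBundle n M)) (x : M) : Set (JetFibre n) :=
  {j | (⟨x, j⟩ : JetBundle n M) ∈ F}

/-- Subequations: subsets of `J²(M)` with the positivity condition (P), the negativity
condition (N) and the topological condition (T). -/
structure IsSubequation (F : Set (JetBundle n M)) : Prop where
  positivity : ∀ (x : M) (j : JetFibre n) (P : SymForm n), (∀ v, 0 ≤ P.1 v v) →
    j ∈ fibre F x → j + (0, 0, P) ∈ fibre F x
  negativity : ∀ (x : M) (j : JetFibre n) (c : ℝ), c ≤ 0 →
    j ∈ fibre F x → j + (c, 0, 0) ∈ fibre F x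
  closure_interior : F = closure (interior F)
  closure_interior_fibre : ∀ x, fibre F x = closure (interior (fibre F x))
  fibre_closure_interior : ∀ x,
    closure (interior (fibre F x)) = fibre (closure (interior F)) x

/-- The Dirichlet dual `-(∁ Int F)`. -/
def dual (F : Set (JetBundle n M)) : Set (JetBundle n M) :=
  {J | (⟨J.base, -J.jet⟩ : JetBundle n M) ∉ interior F}

/-- `u ∈ F(W)` for an open set `W`: `u` is upper semicontinuous on `W` with values in `[-∞, ∞)`,
and every `C²` test function which touches `u` from above at a point of `W` has its 2-jet there
in `F`. Only the values of `u` on `W` matter. -/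
structure IsSubharmonicOn (F : Set (JetBundle n M)) (W : Set M) (u : M → EReal) : Prop where
  usc : UpperSemicontinuousOn u W
  lt_top : ∀ x ∈ W, u x < ⊤
  test : ∀ x ∈ W, ∀ ψ : M → ℝ, ContMDiffAt (𝓡 n) 𝓘(ℝ, ℝ) 2 ψ x →
    (∀ᶠ y in 𝓝 x, u y ≤ (ψ y : EReal)) → u x = (ψ x : EReal) → jetAt ψ x ∈ F

/-- `u ∈ F(K)` for a compact set `K`: `u ∈ USC(K)` and `u ∈ F(Int K)`. -/
structure IsSubharmonicOnCompact (F : Set (JetBundle n M)) (K : Set M) (u : M → EReal) :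
    Prop where
  usc : UpperSemicontinuousOn u K
  lt_top : ∀ x ∈ K, u x < ⊤
  sub : IsSubharmonicOn F (interior K) u

/-- Comparison holds for `F` on `M`: for all compact `K`, `u ∈ F(K)` and `v ∈ F̃(K)`, the zero
maximum principle holds for `u + v` on `K`. -/
def ComparisonHolds (F : Set (JetBundle n M)) : Prop :=
  ∀ K : Set M, IsCompact K → ∀ u v : M → EReal,
    IsSubharmonicOnCompact F K u → IsSubharmonicOnCompact (dual F) K v →
    (∀ x ∈ frontier K, u x + v x ≤ 0) → ∀ x ∈ K, u x + v x ≤ 0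

/-- `u` is bounded below on `W`. -/
def BoundedBelowOn (W : Set M) (u : M → EReal) : Prop :=
  ∃ c : ℝ, ∀ x ∈ W, (c : EReal) ≤ u x

/-! ### Domains whose closure is a manifold with corners, and their boundary -/

/-- `e` is a smooth chart of `M` around `x` in which `closure U` becomes
`{z | zᵢ ≥ 0 for i ∈ s}`, and `U` its interior, where the coordinates in `s` vanish at `x`; the
number of elements of `s` is then the depth of `x`. -/
structure IsCornerChart (U : Set M) (x : M) (e : OpenPartialHomeomorph M (Eu n))
    (s : Finset (Fin n)) : Prop where
  mem_maximalAtlas : e ∈ IsManifold.maximalAtlas (𝓡 n) ∞ M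
  mem_source : x ∈ e.source
  apply_eq_zero : ∀ i ∈ s, e x i = 0
  mem_closure_iff : ∀ y ∈ e.source, y ∈ closure U ↔ ∀ i ∈ s, 0 ≤ e y i
  mem_iff : ∀ y ∈ e.source, y ∈ U ↔ ∀ i ∈ s, 0 < e y i

/-- `closure U` is a manifold with corners, of codimension zero in `M`, with interior `U`. -/
def ClosureHasCorners (n : ℕ) {M : Type*} [TopologicalSpace M] [ChartedSpace (Eu n) M]
    (U : Set M) : Prop :=
  ∀ x ∈ closure U, ∃ (e : OpenPartialHomeomorph M (Eu n)) (s : Finset (Fin n)),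
    IsCornerChart U x e s

/-- The stratum `S¹` of the points of depth one of `closure U`. -/
def depthOne (n : ℕ) {M : Type*} [TopologicalSpace M] [ChartedSpace (Eu n) M]
    (U : Set M) : Set M :=
  {x | ∃ (e : OpenPartialHomeomorph M (Eu n)) (s : Finset (Fin n)),
    IsCornerChart U x e s ∧ s.card = 1}

/-- The boundary `∂U` of `closure U` as a manifold with corners. Its points are the pairs of a point
`pt` and a local boundary component at `pt`, that is, a compatible choice of a connected
component of `V ∩ S¹` for all open neighbourhoods `V` of `pt`. The map `i_U` is
`CornerBoundary.pt`. -/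
structure CornerBoundary (n : ℕ) {M : Type*} [TopologicalSpace M] [ChartedSpace (Eu n) M]
    (U : Set M) where
  pt : M
  comp : TopologicalSpace.OpenNhdsOf pt → Set M
  comp_isComponent : ∀ V : TopologicalSpace.OpenNhdsOf pt, ∃ y ∈ (V : Set M) ∩ depthOne n U,
    comp V = connectedComponentIn ((V : Set M) ∩ depthOne n U) y
  comp_mono : ∀ V V' : TopologicalSpace.OpenNhdsOf pt, (V : Set M) ⊆ V' → comp V ⊆ comp V'

/-- The topology of `∂U`: a basic open set consists of the pairs with `pt ∈ V` whose local boundary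
component selects a given component `W` of `V ∩ S¹`. -/
instance (U : Set M) : TopologicalSpace (CornerBoundary n U) :=
  TopologicalSpace.generateFrom
    {N | ∃ (V : TopologicalSpace.Opens M) (W : Set M),
      N = {b : CornerBoundary n U | ∃ h : b.pt ∈ V, b.comp ⟨V, h⟩ = W}}

/-- `closure U` is a manifold with embedded corners: it is a manifold with corners, and `∂U` is the
disjoint union of finitely many open and closed sets on each of which `i_U` is injective. -/
def ClosureHasEmbeddedCorners (n : ℕ) {M : Type*} [TopologicalSpace M] [ChartedSpace (Eu n) M]
    (U : Set M) : Prop :=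
  ClosureHasCorners n U ∧
    ∃ (m : ℕ) (C : Fin m → Set (CornerBoundary n U)),
      (∀ i, IsClopen (C i)) ∧ (∀ i j, i ≠ j → Disjoint (C i) (C j)) ∧ (⋃ i, C i) = univ ∧
      ∀ i, InjOn CornerBoundary.pt (C i)

/-- A function on `∂U` is consistent if it is constant on the fibres of `i_U`. -/
def Consistent {U : Set M} (φ : CornerBoundary n U → ℝ) : Prop :=
  ∀ b b' : CornerBoundary n U, b.pt = b'.pt → φ b = φ b'

/-! ### Boundary convexity -/

/-- The reduced slice `F_r = {J | (r, J) ∈ F}`. -/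
def slice (F : Set (JetBundle n M)) (r : ℝ) : Set (RedJetBundle n M) :=
  {J | (⟨J.base, (r, J.jet)⟩ : JetBundle n M) ∈ F}

/-- The asymptotic interior of a set of reduced jets: the jets with a neighbourhood `N` such that
`t · N` is contained in the set for all large `t`. -/
def asymptoticInterior (G : Set (RedJetBundle n M)) : Set (RedJetBundle n M) :=
  {J | ∃ N ∈ 𝓝 J, ∃ t₀ : ℝ, 0 < t₀ ∧ ∀ t : ℝ, t₀ ≤ t → ∀ J' ∈ N,
    (⟨J'.base, t • J'.jet⟩ : RedJetBundle n M) ∈ G}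

/-- `ρ` is a local defining function, near `b`, of the sheet of the boundary on which `b` lies:
on a neighbourhood `V`, it is smooth, negative on `U`, vanishes within `closure U` exactly on that
sheet, and has nonzero differential there. -/
def IsDefiningFunctionNear {U : Set M} (b : CornerBoundary n U) (ρ : M → ℝ) : Prop :=
  ∃ V : TopologicalSpace.OpenNhdsOf b.pt,
    ContMDiffOn (𝓡 n) 𝓘(ℝ, ℝ) ∞ ρ (V : Set M) ∧
    (∀ y ∈ (V : Set M), y ∈ U → ρ y < 0) ∧
    (∀ y ∈ (V : Set M), y ∈ closure U → (ρ y = 0 ↔ y ∈ closure (b.comp V))) ∧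
    ∀ y ∈ (V : Set M), y ∈ closure (b.comp V) → mfderiv (𝓡 n) 𝓘(ℝ, ℝ) ρ y ≠ 0

/-- The boundary is strictly `F`-convex at `b`: for every real `r` there is a local defining
function whose 2-jet at `b` lies in the asymptotic interior of `F_r`. -/
def StrictlyConvexAt (F : Set (JetBundle n M)) {U : Set M} (b : CornerBoundary n U) : Prop :=
  ∀ r : ℝ, ∃ ρ : M → ℝ, IsDefiningFunctionNear b ρ ∧
    redJetAt ρ b.pt ∈ asymptoticInterior (slice F r)

/-! ### The Dirichlet problem -/

/-- Subsolutions for `(U, φ)`, i.e. the members of the Perron family: `u ∈ USC(closure U)` with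
values in `[-∞, ∞)`, `u ∈ F(U)` and `u ≤ φ` on `∂U`. -/
structure IsSubsolution (F : Set (JetBundle n M)) (U : Set M) (φ : CornerBoundary n U → ℝ)
    (u : M → EReal) : Prop where
  usc : UpperSemicontinuousOn u (closure U)
  lt_top : ∀ x ∈ closure U, u x < ⊤
  sub : IsSubharmonicOn F U u
  le_boundary : ∀ b : CornerBoundary n U, u b.pt ≤ (φ b : EReal)

/-- A set of points of `∂U` is a union of connected components of `∂U`. -/
def IsUnionOfComponents {U : Set M} (A : Set (CornerBoundary n U)) : Prop :=
  ∀ b ∈ A, connectedComponent b ⊆ A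

/-- `∂U` is strictly `(F, φ)`-convex. -/
def StrictlyConvexFor (F : Set (JetBundle n M)) (U : Set M) (φ : CornerBoundary n U → ℝ) :
    Prop :=
  ∃ A B : Set (CornerBoundary n U),
    IsUnionOfComponents A ∧ IsUnionOfComponents B ∧ A ∪ B = univ ∧ Disjoint A B ∧
    (∀ p ∈ A, ∀ δ : ℝ, 0 < δ → ∃ u : M → ℝ, ContinuousOn u (closure U) ∧
      IsSubsolution F U φ (fun x => (u x : EReal)) ∧ φ p - δ ≤ u p.pt) ∧
    ∀ p ∈ B, StrictlyConvexAt F p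

/-- The Perron function `u_φ`, the upper envelope of the Perron family. -/
def perron (F : Set (JetBundle n M)) (U : Set M) (φ : CornerBoundary n U → ℝ) (x : M) : EReal :=
  sSup {t : EReal | ∃ u : M → EReal, IsSubsolution F U φ u ∧ u x = t}

/-- `g` solves the `F`-Dirichlet problem for `(U, φ)`: it is continuous on `closure U`,
`F`-harmonic on `U`, and equal to `φ` on `∂U`. -/
structure SolvesDirichlet (F : Set (JetBundle n M)) (U : Set M) (φ : CornerBoundary n U → ℝ)
    (g : M → ℝ) : Prop where
  continuousOn : ContinuousOn g (closure U)
  sub : IsSubharmonicOn F U (fun x => (g x : EReal))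
  neg_sub : IsSubharmonicOn (dual F) U (fun x => ((-g x : ℝ) : EReal))
  boundary : ∀ b : CornerBoundary n U, g b.pt = φ b

end Jets

end DirichletDuality

end

/-! The proof is Perron's method: comparison supplies upper bounds and uniqueness, convexity of the
boundary supplies the boundary values. Call the subsolutions for `dual F` and `-φ` dual
subsolutions. The topological boundary of `closure U` is `closure U \ U`, and each of its points
underlies a point of `∂U`; comparison on `closure U` therefore gives `w + v ≤ 0` for every
subsolution `w` and every dual subsolution `v`.

Barriers. At a strictly convex boundary point, a defining function minus a small multiple of the
squared distance is `≤ 0` on `closure U` and vanishes, locally, only at that point. By the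
definition of the asymptotic interior, its large multiples plus a constant are subharmonic
(`IsMonotone.exists_barrier`). Away from the point such a multiple drops below any function bounded
from below. Its maximum with a bounded subharmonic function lying below the boundary values is thus
a subsolution that is almost `φ b` near `b` (`IsMonotone.exists_subsolution_near`). The bounded
function is a continuous subsolution if the part `A` of the boundary is non-empty. Otherwise it is
glued from barriers and the given function bounded from below
(`IsMonotone.exists_bounded_of_strictlyConvexAt`). This uses (P) and (N) only, which pass to the
dual (`IsMonotone.dual`), so it applies to both sides.

Envelopes. Let `H` be the upper semicontinuous regularization of the Perron function. Comparison
with dual subsolutions gives `H ≤ φ` on the boundary, and closedness of `F` gives `H ∈ F(U)`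
(`satisfiesTestAt_uscHull`). So `H` is itself a subsolution, and equals the Perron function. Let `N`
be the regularization of `-H`. If `N` failed the test for the dual, the negative of the test
function, slightly raised, could be glued into `H` to give a larger subsolution
(`satisfiesTestAt_dual_of_maximal`). Subsolutions near the boundary give `N ≤ -φ` there. Now
comparison yields `H + N ≤ 0`, while `N ≥ -H` by construction. Hence `N = -H`, so `H` is also lower
semicontinuous and solves the problem. Uniqueness is comparison of two solutions in both orders
(`SolvesDirichlet.le`). -/

noncomputable section

namespace DirichletDuality

/-! ### Calculus of 2-jets on `ℝⁿ` -/

section JetCalculus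

variable {n : ℕ}

/-- The 2-jet of a function on `ℝⁿ`. -/
def jetEu (f : Eu n → ℝ) (z : Eu n) : JetFibre n :=
  (f z, fderiv ℝ f z, symPart (fderiv ℝ (fderiv ℝ f) z))

/-- The pull-back of a bilinear form by a linear map. -/
def quadPull (D : Eu n →L[ℝ] Eu n) (A : BilForm n) : BilForm n := A.bilinearComp D D

@[simp] theorem quadPull_apply (D : Eu n →L[ℝ] Eu n) (A : BilForm n) (v w : Eu n) :
    quadPull D A v w = A (D v) (D w) := rfl

/-- The pull-back of a 2-jet by a 2-jet of maps with derivatives `D` and `B`. -/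
def jetPull (D : Eu n →L[ℝ] Eu n) (B : Eu n →L[ℝ] Eu n →L[ℝ] Eu n) (j : JetFibre n) : JetFibre n :=
  (j.1, j.2.1.comp D,
    symPart (quadPull D j.2.2.1 + (ContinuousLinearMap.compL ℝ (Eu n) (Eu n) ℝ j.2.1).comp B))

theorem symPart_apply (B : BilForm n) (v w : Eu n) :
    (symPart B).1 v w = (1 / 2 : ℝ) * (B v w + B w v) := rfl

theorem bilForm_ext {A B : BilForm n} (h : ∀ v w, A v w = B v w) : A = B :=
  ContinuousLinearMap.ext fun v => ContinuousLinearMap.ext fun w => h v w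

theorem symForm_ext {A B : SymForm n} (h : ∀ v w, A.1 v w = B.1 v w) : A = B :=
  Subtype.ext (bilForm_ext h)

theorem continuous_symPart : Continuous (symPart : BilForm n → SymForm n) := by
  refine Continuous.subtype_mk ?_ _
  have h : Continuous fun B : BilForm n => B.flip :=
    (ContinuousLinearMap.flipₗᵢ ℝ (Eu n) (Eu n) ℝ).continuous
  exact (continuous_id.add h).const_smul (1 / 2 : ℝ)

theorem jetEu_congr {f g : Eu n → ℝ} {z : Eu n} (h : f =ᶠ[𝓝 z] g) : jetEu f z = jetEu g z := by
  unfold jetEu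
  rw [h.eq_of_nhds, h.fderiv_eq, h.fderiv.fderiv_eq]

theorem fderiv_fderiv_comp {f : Eu n → ℝ} {σ : Eu n → Eu n} {z : Eu n}
    (hσ : ContDiffAt ℝ 2 σ z) (hf : ContDiffAt ℝ 2 f (σ z)) :
    fderiv ℝ (fderiv ℝ (f ∘ σ)) z =
      quadPull (fderiv ℝ σ z) (fderiv ℝ (fderiv ℝ f) (σ z)) +
        (ContinuousLinearMap.compL ℝ (Eu n) (Eu n) ℝ (fderiv ℝ f (σ z))).comp
          (fderiv ℝ (fderiv ℝ σ) z) := by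
  have hσ1 : ∀ᶠ y in 𝓝 z, ContDiffAt ℝ 2 σ y := hσ.eventually (by simp)
  have hf1 : ∀ᶠ y in 𝓝 z, ContDiffAt ℝ 2 f (σ y) :=
    hσ.continuousAt.eventually (hf.eventually (by simp))
  have h1 : fderiv ℝ (f ∘ σ) =ᶠ[𝓝 z] fun y => (fderiv ℝ f (σ y)).comp (fderiv ℝ σ y) := by
    filter_upwards [hσ1, hf1] with y h2 h3
    exact fderiv_comp y (h3.differentiableAt (by simp)) (h2.differentiableAt (by simp))
  have hdf : DifferentiableAt ℝ (fderiv ℝ f) (σ z) :=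
    (hf.fderiv_right (m := 1) (by norm_num)).differentiableAt (by simp)
  have hdσ : DifferentiableAt ℝ (fderiv ℝ σ) z :=
    (hσ.fderiv_right (m := 1) (by norm_num)).differentiableAt (by simp)
  have hσd : DifferentiableAt ℝ σ z := hσ.differentiableAt (by simp)
  have h2 := (hdf.hasFDerivAt.comp z hσd.hasFDerivAt).clm_comp hdσ.hasFDerivAt
  rw [h1.fderiv_eq]
  refine h2.fderiv.trans ?_
  refine bilForm_ext fun v w => ?_
  simp [add_comm]

/-- This is the chain rule to second order. The Hessian of a `C²` function is symmetric, so
replacing it by its symmetric part inside `jetPull` loses nothing. -/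
theorem jetEu_comp {f : Eu n → ℝ} {σ : Eu n → Eu n} {z : Eu n}
    (hσ : ContDiffAt ℝ 2 σ z) (hf : ContDiffAt ℝ 2 f (σ z)) :
    jetEu (f ∘ σ) z = jetPull (fderiv ℝ σ z) (fderiv ℝ (fderiv ℝ σ) z) (jetEu f (σ z)) := by
  have hs : IsSymmSndFDerivAt ℝ f (σ z) := hf.isSymmSndFDerivAt (by simp)
  have hA : (symPart (fderiv ℝ (fderiv ℝ f) (σ z))).1 = fderiv ℝ (fderiv ℝ f) (σ z) := by
    refine bilForm_ext fun v w => ?_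
    rw [symPart_apply, hs.eq v w]
    ring
  refine Prod.ext rfl (Prod.ext ?_ ?_)
  · exact fderiv_comp z (hf.differentiableAt (by simp)) (hσ.differentiableAt (by simp))
  · change symPart (fderiv ℝ (fderiv ℝ (f ∘ σ)) z) = _
    rw [fderiv_fderiv_comp hσ hf]
    simp only [jetPull, jetEu, hA]

/-- The polynomial on `ℝⁿ` with given 2-jet at `z`. -/
def jetPoly (z : Eu n) (j : JetFibre n) (y : Eu n) : ℝ :=
  j.1 + j.2.1 (y - z) + (1 / 2) * j.2.2.1 (y - z) (y - z)

theorem contDiff_jetPoly (z : Eu n) (j : JetFibre n) : ContDiff ℝ 2 (jetPoly z j) := by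
  unfold jetPoly
  have h : ContDiff ℝ 2 fun y : Eu n => y - z := contDiff_id.sub contDiff_const
  have h2 : ContDiff ℝ 2 fun y : Eu n => j.2.2.1 (y - z) (y - z) :=
    ((j.2.2.1.contDiff).comp h).clm_apply h
  exact (contDiff_const.add (j.2.1.contDiff.comp h)).add (contDiff_const.mul h2)

theorem jetEu_jetPoly (z : Eu n) (j : JetFibre n) : jetEu (jetPoly z j) z = j := by
  have h1 : fderiv ℝ (jetPoly z j) = fun y => j.2.1 + j.2.2.1 (y - z) := by
    funext y
    have hy : HasFDerivAt (fun y : Eu n => y - z) (ContinuousLinearMap.id ℝ (Eu n)) y :=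
      (hasFDerivAt_id y).sub_const z
    have ha := (j.2.1.hasFDerivAt (x := y - z)).comp y hy
    have hb := ((j.2.2.1.hasFDerivAt (x := y - z)).comp y hy).clm_apply hy
    have hc := ((hasFDerivAt_const j.1 y).add ha).add (hb.const_mul (1 / 2))
    refine HasFDerivAt.fderiv (hc.congr_fderiv ?_)
    ext v
    have hs : j.2.2.1 v (y - z) = j.2.2.1 (y - z) v := j.2.2.2 _ _
    simp only [_root_.add_apply, _root_.smul_apply,
      ContinuousLinearMap.comp_apply, ContinuousLinearMap.flip_apply,
      ContinuousLinearMap.id_apply, _root_.zero_apply, smul_eq_mul,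
      Function.comp_apply, hs]
    ring
  have h2 : fderiv ℝ (fderiv ℝ (jetPoly z j)) z = j.2.2.1 := by
    rw [h1]
    have hy : HasFDerivAt (fun y : Eu n => y - z) (ContinuousLinearMap.id ℝ (Eu n)) z :=
      (hasFDerivAt_id z).sub_const z
    have := ((j.2.2.1.hasFDerivAt (x := z - z)).comp (f := fun y : Eu n => y - z) z hy).const_add
      j.2.1
    exact this.fderiv
  refine Prod.ext (by simp [jetEu, jetPoly]) (Prod.ext ?_ ?_)
  · simp [jetEu, h1]
  · change symPart _ = _
    rw [h2]
    exact symPart_of_symm _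

theorem jetEu_add {f g : Eu n → ℝ} {z : Eu n} (hf : ContDiffAt ℝ 2 f z)
    (hg : ContDiffAt ℝ 2 g z) : jetEu (fun y => f y + g y) z = jetEu f z + jetEu g z := by
  have h1 : fderiv ℝ (fun y => f y + g y) =ᶠ[𝓝 z] fun y => fderiv ℝ f y + fderiv ℝ g y := by
    filter_upwards [hf.eventually (by simp), hg.eventually (by simp)] with y h2 h3
    exact fderiv_fun_add (h2.differentiableAt (by simp)) (h3.differentiableAt (by simp))
  have h2 : fderiv ℝ (fderiv ℝ (fun y => f y + g y)) z =
      fderiv ℝ (fderiv ℝ f) z + fderiv ℝ (fderiv ℝ g) z := by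
    rw [h1.fderiv_eq]
    exact fderiv_fun_add
      ((hf.fderiv_right (m := 1) (by norm_num)).differentiableAt (by simp))
      ((hg.fderiv_right (m := 1) (by norm_num)).differentiableAt (by simp))
  refine Prod.ext rfl (Prod.ext h1.eq_of_nhds ?_)
  change symPart _ = symPart _ + symPart _
  rw [h2]
  refine symForm_ext fun v w => ?_
  change _ = (symPart _).1 v w + (symPart _).1 v w
  simp only [symPart_apply]
  simp only [_root_.add_apply]
  ring

theorem jetEu_const_mul (c : ℝ) {f : Eu n → ℝ} {z : Eu n} (hf : ContDiffAt ℝ 2 f z) :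
    jetEu (fun y => c * f y) z = c • jetEu f z := by
  have h1 : fderiv ℝ (fun y => c * f y) =ᶠ[𝓝 z] fun y => c • fderiv ℝ f y := by
    filter_upwards [hf.eventually (by simp)] with y h2
    exact fderiv_const_mul (h2.differentiableAt (by simp)) c
  have h2 : fderiv ℝ (fderiv ℝ (fun y => c * f y)) z = c • fderiv ℝ (fderiv ℝ f) z := by
    rw [h1.fderiv_eq]
    exact fderiv_fun_const_smul
      ((hf.fderiv_right (m := 1) (by norm_num)).differentiableAt (by simp)) c
  refine Prod.ext rfl (Prod.ext h1.eq_of_nhds ?_)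
  change symPart _ = c • symPart _
  rw [h2]
  refine symForm_ext fun v w => ?_
  change _ = c * (symPart _).1 v w
  simp only [symPart_apply]
  simp only [_root_.smul_apply, smul_eq_mul]
  ring

theorem jetEu_const (c : ℝ) (z : Eu n) : jetEu (fun _ => c) z = (c, 0, 0) := by
  have h := jetEu_jetPoly z (c, 0, 0)
  have h1 : jetPoly z (c, 0, 0) = fun _ => c := by
    funext y
    simp [jetPoly]
  rwa [h1] at h

theorem continuousAt_jetEu {f : Eu n → ℝ} {z : Eu n} (hf : ContDiffAt ℝ 2 f z) :
    ContinuousAt (jetEu f) z := by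
  have h1 : ContDiffAt ℝ 1 (fderiv ℝ f) z := hf.fderiv_right (m := 1) (by norm_num)
  have h2 : ContDiffAt ℝ 0 (fderiv ℝ (fderiv ℝ f)) z := h1.fderiv_right (m := 0) (by norm_num)
  exact hf.continuousAt.prodMk
    (h1.continuousAt.prodMk (continuous_symPart.continuousAt.comp h2.continuousAt))

/-- Second order necessary condition at a local minimum. -/
theorem jetEu_of_isLocalMin {h : Eu n → ℝ} {z : Eu n} (hh : ContDiffAt ℝ 2 h z)
    (hz : h z = 0) (hmin : ∀ᶠ y in 𝓝 z, 0 ≤ h y) :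
    ∃ P : SymForm n, (∀ v, 0 ≤ P.1 v v) ∧ jetEu h z = (0, 0, P) := by
  have hm : IsLocalMin h z := by
    filter_upwards [hmin] with y hy
    rw [hz]
    exact hy
  refine ⟨symPart (fderiv ℝ (fderiv ℝ h) z), fun v => ?_,
    Prod.ext hz (Prod.ext hm.fderiv_eq_zero rfl)⟩
  have hv : (symPart (fderiv ℝ (fderiv ℝ h) z)).1 v v = fderiv ℝ (fderiv ℝ h) z v v := by
    rw [symPart_apply]
    ring
  rw [hv]
  by_contra! hneg
  -- restrict to the line through `z` in direction `v`
  set l : ℝ → Eu n := fun t => z + t • v with hl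
  have hlt : ∀ t, HasDerivAt l v t := fun t =>
    (((hasDerivAt_id t).smul_const v).const_add z).congr_deriv (one_smul ℝ v)
  have hl0 : l 0 = z := by simp [hl]
  have hlc : Tendsto l (𝓝 0) (𝓝 z) := by
    have := (hlt 0).continuousAt
    rwa [ContinuousAt, hl0] at this
  have hd : ∀ᶠ t in 𝓝 (0 : ℝ), HasDerivAt (h ∘ l) (fderiv ℝ h (l t) v) t := by
    filter_upwards [hlc.eventually (hh.eventually (by simp))] with t ht
    exact (ht.differentiableAt (by simp)).hasFDerivAt.comp_hasDerivAt t (hlt t)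
  have hde : deriv (h ∘ l) =ᶠ[𝓝 0] fun t => fderiv ℝ h (l t) v := hd.mono fun t ht => ht.deriv
  have h2 : HasDerivAt (fun t => fderiv ℝ h (l t) v) (fderiv ℝ (fderiv ℝ h) z v v) 0 := by
    have hdf : DifferentiableAt ℝ (fderiv ℝ h) (l 0) := by
      rw [hl0]
      exact (hh.fderiv_right (m := 1) (by norm_num)).differentiableAt (by simp)
    have := (hdf.hasFDerivAt.comp_hasDerivAt 0 (hlt 0)).clm_apply (hasDerivAt_const (0 : ℝ) v)
    rw [hl0] at this
    simpa using this
  have hdd : deriv (deriv (h ∘ l)) 0 = fderiv ℝ (fderiv ℝ h) z v v := by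
    rw [hde.deriv_eq, h2.deriv]
  have hd0 : deriv (h ∘ l) 0 = 0 := by
    rw [hde.eq_of_nhds]
    simp [hl0, hm.fderiv_eq_zero]
  -- A negative second derivative would make `0` a local maximum as well as a local minimum. Then `h
  -- ∘ l` is constant near `0`, and its second derivative vanishes.
  have hmax : IsLocalMax (h ∘ l) 0 := isLocalMax_of_deriv_deriv_neg (by rw [hdd]; exact hneg) hd0
    hd.self_of_nhds.continuousAt
  have hconst : h ∘ l =ᶠ[𝓝 0] fun _ => 0 := by
    filter_upwards [hmax, hlc.eventually hmin] with t h3 h4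
    have h5 : (h ∘ l) 0 = 0 := by simp [hl0, hz]
    rw [h5] at h3
    exact le_antisymm h3 h4
  have : deriv (deriv (h ∘ l)) 0 = 0 := by
    rw [hconst.deriv.deriv_eq]
    simp
  rw [hdd] at this
  linarith

theorem continuous_quadPull (A : BilForm n) :
    Continuous fun D : Eu n →L[ℝ] Eu n => quadPull D A := by
  have hflip : Continuous fun B : BilForm n => B.flip :=
    (ContinuousLinearMap.flipₗᵢ ℝ (Eu n) (Eu n) ℝ).continuous
  have h1 : Continuous fun D : Eu n →L[ℝ] Eu n => (A.comp D).flip :=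
    hflip.comp (continuous_const.clm_comp continuous_id)
  exact hflip.comp (h1.clm_comp continuous_id)

end JetCalculus

/-! ### Jets on manifolds and the topology of the jet bundle -/

section JetTopology

variable {n : ℕ} {M : Type*} [TopologicalSpace M] [ChartedSpace (Eu n) M]

theorem jetAt_eq (f : M → ℝ) (x : M) :
    jetAt (n := n) f x = ⟨x, jetEu (f ∘ (chartAt (Eu n) x).symm) (chartAt (Eu n) x x)⟩ := by
  unfold jetAt jetEu
  simp [(chartAt (Eu n) x).left_inv (mem_chart_source (Eu n) x)]

theorem isOpen_jetBundle_iff {O : Set (JetBundle n M)} :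
    IsOpen O ↔ ∀ e ∈ atlas (Eu n) M,
      IsOpen {q : e.target × JetFibre n | jetParam e (q.1 : Eu n) q.2 ∈ O} := by
  rw [isOpen_iSup_iff]
  simp only [isOpen_coinduced, Subtype.forall]
  rfl

theorem continuous_jetParam {e : OpenPartialHomeomorph M (Eu n)} (he : e ∈ atlas (Eu n) M) :
    Continuous fun q : e.target × JetFibre n => jetParam e (q.1 : Eu n) q.2 :=
  ⟨fun _ hO => isOpen_jetBundle_iff.1 hO e he⟩

theorem continuousAt_jetParam {e : OpenPartialHomeomorph M (Eu n)} (he : e ∈ atlas (Eu n) M)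
    {z : Eu n} (hz : z ∈ e.target) (j : JetFibre n) :
    ContinuousAt (fun q : Eu n × JetFibre n => jetParam e q.1 q.2) (z, j) := by
  have h : ContinuousOn (fun q : Eu n × JetFibre n => jetParam e q.1 q.2) (e.target ×ˢ univ) := by
    rw [continuousOn_iff_continuous_domRestrict]
    have h1 : Continuous fun q : ↥(e.target ×ˢ (univ : Set (JetFibre n))) =>
        ((⟨q.1.1, q.2.1⟩, q.1.2) : e.target × JetFibre n) := by fun_prop
    exact (continuous_jetParam he).comp h1
  exact h.continuousAt ((e.open_target.prod isOpen_univ).mem_nhds ⟨hz, mem_univ _⟩)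

theorem contDiffAt_comp_symm {e : OpenPartialHomeomorph M (Eu n)}
    (he : e ∈ IsManifold.maximalAtlas (𝓡 n) ∞ M) {x : M} (hx : x ∈ e.source) {f : M → ℝ}
    (hf : ContMDiffAt (𝓡 n) 𝓘(ℝ, ℝ) 2 f x) : ContDiffAt ℝ 2 (f ∘ e.symm) (e x) := by
  have h1 : ContMDiffAt (𝓡 n) (𝓡 n) 2 e.symm (e x) :=
    (contMDiffAt_symm_of_mem_maximalAtlas he (e.map_source hx)).of_le (ENat.LEInfty.out (m := 2))
  have h2 : ContMDiffAt (𝓡 n) 𝓘(ℝ, ℝ) 2 f (e.symm (e x)) := by rwa [e.left_inv hx]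
  exact (h2.comp (e x) h1).contDiffAt

theorem contMDiffAt_chart {e : OpenPartialHomeomorph M (Eu n)}
    (he : e ∈ IsManifold.maximalAtlas (𝓡 n) ∞ M) {x : M} (hx : x ∈ e.source) :
    ContMDiffAt (𝓡 n) (𝓡 n) 2 e x :=
  (contMDiffAt_of_mem_maximalAtlas he hx).of_le (ENat.LEInfty.out (m := 2))

theorem contDiffAt_transition {e c : OpenPartialHomeomorph M (Eu n)}
    (he : e ∈ IsManifold.maximalAtlas (𝓡 n) ∞ M) (hc : c ∈ IsManifold.maximalAtlas (𝓡 n) ∞ M)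
    {x : M} (hx : x ∈ e.source) (hx' : x ∈ c.source) : ContDiffAt ℝ 2 (e ∘ c.symm) (c x) := by
  have h1 : ContMDiffAt (𝓡 n) (𝓡 n) 2 c.symm (c x) :=
    (contMDiffAt_symm_of_mem_maximalAtlas hc (c.map_source hx')).of_le (ENat.LEInfty.out (m := 2))
  have h2 : ContMDiffAt (𝓡 n) (𝓡 n) 2 e (c.symm (c x)) := by
    rw [c.left_inv hx']
    exact contMDiffAt_chart he hx
  exact (h2.comp (c x) h1).contDiffAt

/-- The squared distance to `x` in the preferred chart at `x`. -/
def sqDist (n : ℕ) {M : Type*} [TopologicalSpace M] [ChartedSpace (Eu n) M] (x y : M) : ℝ :=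
  ‖chartAt (Eu n) x y - chartAt (Eu n) x x‖ ^ 2

theorem sqDist_nonneg (x y : M) : 0 ≤ sqDist n x y := by
  unfold sqDist
  positivity

theorem sqDist_self (x : M) : sqDist n x x = 0 := by simp [sqDist]

/-- The perturbation `f - ε |· - x|² + s` of a function. -/
def perturb (n : ℕ) {M : Type*} [TopologicalSpace M] [ChartedSpace (Eu n) M] (x : M) (f : M → ℝ)
    (ε s : ℝ) (y : M) : ℝ := f y + (-ε) * sqDist n x y + s

/-- Conditions (P) and (N). -/
structure IsMonotone (G : Set (JetBundle n M)) : Prop where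
  positivity : ∀ (x : M) (j : JetFibre n) (P : SymForm n), (∀ v, 0 ≤ P.1 v v) →
    j ∈ fibre G x → j + (0, 0, P) ∈ fibre G x
  negativity : ∀ (x : M) (j : JetFibre n) (c : ℝ), c ≤ 0 →
    j ∈ fibre G x → j + (c, 0, 0) ∈ fibre G x

theorem IsSubequation.isMonotone {F : Set (JetBundle n M)} (hF : IsSubequation F) :
    IsMonotone F :=
  ⟨hF.positivity, hF.negativity⟩

/-! ### Change of charts for jets, and continuity of jets in the point. -/

variable [IsManifold (𝓡 n) ∞ M]

/-- The linear map of 2-jets at `x` belonging to the change from the chart `e` to the preferred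
chart at `x`. -/
def toPreferred (e : OpenPartialHomeomorph M (Eu n)) (x : M) (j : JetFibre n) : JetFibre n :=
  jetPull (fderiv ℝ (e ∘ (chartAt (Eu n) x).symm) (chartAt (Eu n) x x))
    (fderiv ℝ (fderiv ℝ (e ∘ (chartAt (Eu n) x).symm)) (chartAt (Eu n) x x)) j

theorem jetAt_eq_toPreferred {e : OpenPartialHomeomorph M (Eu n)}
    (he : e ∈ IsManifold.maximalAtlas (𝓡 n) ∞ M) {x : M} (hx : x ∈ e.source) {f : M → ℝ}
    (hf : ContMDiffAt (𝓡 n) 𝓘(ℝ, ℝ) 2 f x) :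
    jetAt (n := n) f x = ⟨x, toPreferred e x (jetEu (f ∘ e.symm) (e x))⟩ := by
  set c := chartAt (Eu n) x with hc
  have hxc : x ∈ c.source := mem_chart_source (Eu n) x
  have hσ : ContDiffAt ℝ 2 (e ∘ c.symm) (c x) :=
    contDiffAt_transition he (IsManifold.chart_mem_maximalAtlas x) hx hxc
  have hval : (e ∘ c.symm) (c x) = e x := by simp [c.left_inv hxc]
  have hg : ContDiffAt ℝ 2 (f ∘ e.symm) ((e ∘ c.symm) (c x)) := by
    rw [hval]
    exact contDiffAt_comp_symm he hx hf
  have heq : f ∘ c.symm =ᶠ[𝓝 (c x)] (f ∘ e.symm) ∘ (e ∘ c.symm) := by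
    have : ∀ᶠ z in 𝓝 (c x), c.symm z ∈ e.source :=
      (c.continuousAt_symm (c.map_source hxc)).eventually
        (by rw [c.left_inv hxc]; exact e.open_source.mem_nhds hx)
    filter_upwards [this] with z hz
    simp [e.left_inv hz]
  rw [jetAt_eq, ← hc, jetEu_congr heq, jetEu_comp hσ hg, hval]
  rfl

theorem jetParam_eq {e : OpenPartialHomeomorph M (Eu n)}
    (he : e ∈ IsManifold.maximalAtlas (𝓡 n) ∞ M) {z : Eu n} (hz : z ∈ e.target) (j : JetFibre n) :
    jetParam e z j = ⟨e.symm z, toPreferred e (e.symm z) j⟩ := by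
  have hx := e.map_target hz
  have h1 : ContMDiffAt (𝓡 n) 𝓘(ℝ, ℝ) 2 (jetPoly z j ∘ e) (e.symm z) :=
    (contDiff_jetPoly z j).contDiffAt.contMDiffAt.comp (e.symm z) (contMDiffAt_chart he hx)
  have h2 := jetAt_eq_toPreferred he hx h1
  have h3 : (jetPoly z j ∘ e) ∘ e.symm =ᶠ[𝓝 z] jetPoly z j := by
    filter_upwards [e.open_target.mem_nhds hz] with y hy
    simp [e.right_inv hy]
  rw [e.right_inv hz, jetEu_congr h3, jetEu_jetPoly] at h2
  exact h2

/-- The preferred chart may jump from point to point. Writing the jets at all points near `x`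
through one fixed chart is what makes them visibly continuous. -/
theorem jetAt_eq_jetParam {e : OpenPartialHomeomorph M (Eu n)}
    (he : e ∈ IsManifold.maximalAtlas (𝓡 n) ∞ M) {x : M} (hx : x ∈ e.source) {f : M → ℝ}
    (hf : ContMDiffAt (𝓡 n) 𝓘(ℝ, ℝ) 2 f x) :
    jetAt (n := n) f x = jetParam e (e x) (jetEu (f ∘ e.symm) (e x)) := by
  rw [jetParam_eq he (e.map_source hx), e.left_inv hx, jetAt_eq_toPreferred he hx hf]

theorem contMDiffAt_eventually {f : M → ℝ} {x : M} (hf : ContMDiffAt (𝓡 n) 𝓘(ℝ, ℝ) 2 f x) :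
    ∀ᶠ y in 𝓝 x, ContMDiffAt (𝓡 n) 𝓘(ℝ, ℝ) 2 f y :=
  contMDiffAt_iff_contMDiffAt_nhds (by simp) |>.1 hf

theorem contMDiffAt_sqDist {x y : M} (hy : y ∈ (chartAt (Eu n) x).source) :
    ContMDiffAt (𝓡 n) 𝓘(ℝ, ℝ) 2 (sqDist n x) y := by
  have h : ContDiff ℝ 2 fun z : Eu n => ‖z - chartAt (Eu n) x x‖ ^ 2 :=
    (contDiff_id.sub contDiff_const).norm_sq ℝ
  exact h.contDiffAt.contMDiffAt.comp y
    (contMDiffAt_chart (IsManifold.chart_mem_maximalAtlas x) hy)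

theorem contMDiffAt_perturb {x y : M} {f : M → ℝ} (hf : ContMDiffAt (𝓡 n) 𝓘(ℝ, ℝ) 2 f y)
    (hy : y ∈ (chartAt (Eu n) x).source) (ε s : ℝ) :
    ContMDiffAt (𝓡 n) 𝓘(ℝ, ℝ) 2 (perturb n x f ε s) y := by
  have h1 : ContDiff ℝ 2 fun p : ℝ × ℝ => p.1 + (-ε) * p.2 + s := by fun_prop
  exact h1.contDiffAt.contMDiffAt.comp y (hf.prodMk_space (contMDiffAt_sqDist hy))

theorem jetAt_perturb {x y : M} {f : M → ℝ} (hf : ContMDiffAt (𝓡 n) 𝓘(ℝ, ℝ) 2 f y)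
    (hy : y ∈ (chartAt (Eu n) x).source) (ε s : ℝ) :
    jetAt (n := n) (perturb n x f ε s) y =
      jetParam (chartAt (Eu n) x) (chartAt (Eu n) x y)
        (jetEu (f ∘ (chartAt (Eu n) x).symm) (chartAt (Eu n) x y) +
          (-ε) • jetEu (sqDist n x ∘ (chartAt (Eu n) x).symm) (chartAt (Eu n) x y) +
          (s, 0, 0)) := by
  set c := chartAt (Eu n) x with hc
  have hcm : c ∈ IsManifold.maximalAtlas (𝓡 n) ∞ M := IsManifold.chart_mem_maximalAtlas x
  have h1 := contDiffAt_comp_symm hcm hy hf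
  have h2 := contDiffAt_comp_symm hcm hy (contMDiffAt_sqDist hy)
  have h3 : ContDiffAt ℝ 2 (fun z => (-ε) * (sqDist n x ∘ c.symm) z) (c y) :=
    contDiffAt_const.mul h2
  rw [jetAt_eq_jetParam hcm hy (contMDiffAt_perturb hf hy ε s)]
  congr 1
  rw [← jetEu_const s (c y), ← jetEu_const_mul _ h2, ← jetEu_add h1 h3,
    ← jetEu_add (h1.add h3) contDiffAt_const]
  rfl

/-- Jets of `C²` functions depend continuously on the point and on perturbations. -/
theorem eventually_jetAt_perturb_mem {O : Set (JetBundle n M)} (hO : IsOpen O) {x : M} {f : M → ℝ}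
    (hf : ContMDiffAt (𝓡 n) 𝓘(ℝ, ℝ) 2 f x) (hx : jetAt f x ∈ O) :
    ∀ᶠ p : M × ℝ × ℝ in 𝓝 (x, 0, 0), jetAt (perturb n x f p.2.1 p.2.2) p.1 ∈ O := by
  set c := chartAt (Eu n) x with hc
  have hxc : x ∈ c.source := mem_chart_source (Eu n) x
  have hcm : c ∈ IsManifold.maximalAtlas (𝓡 n) ∞ M := IsManifold.chart_mem_maximalAtlas x
  have hpar := continuousAt_jetParam (chart_mem_atlas (Eu n) x) (c.map_source hxc)
    (jetEu (f ∘ c.symm) (c x))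
  have hc1 : ContinuousAt (fun p : M × ℝ × ℝ => c p.1) (x, 0, 0) :=
    (c.continuousAt hxc).comp continuousAt_fst
  have hj1 : ContinuousAt (fun p : M × ℝ × ℝ => jetEu (f ∘ c.symm) (c p.1)) (x, 0, 0) :=
    ContinuousAt.comp (f := fun p : M × ℝ × ℝ => c p.1)
      (continuousAt_jetEu (contDiffAt_comp_symm hcm hxc hf)) hc1
  have hj2 : ContinuousAt (fun p : M × ℝ × ℝ => jetEu (sqDist n x ∘ c.symm) (c p.1)) (x, 0, 0) :=
    ContinuousAt.comp (f := fun p : M × ℝ × ℝ => c p.1)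
      (continuousAt_jetEu (contDiffAt_comp_symm hcm hxc (contMDiffAt_sqDist hxc))) hc1
  have hε : ContinuousAt (fun p : M × ℝ × ℝ => -p.2.1) (x, 0, 0) := by fun_prop
  have hs : ContinuousAt (fun p : M × ℝ × ℝ => ((p.2.2, 0, 0) : JetFibre n)) (x, 0, 0) := by
    fun_prop
  have hj := (hj1.add (hε.smul hj2)).add hs
  have hpair := hc1.prodMk hj
  have h0 : ((c x, jetEu (f ∘ c.symm) (c x) + (-(0 : ℝ)) • jetEu (sqDist n x ∘ c.symm) (c x) +
      ((0 : ℝ), 0, 0)) : Eu n × JetFibre n) = (c x, jetEu (f ∘ c.symm) (c x)) := by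
    have : (((0 : ℝ), 0, 0) : JetFibre n) = 0 := rfl
    rw [this]
    simp
  have hcomp : ContinuousAt (fun p : M × ℝ × ℝ => jetParam c (c p.1)
      (jetEu (f ∘ c.symm) (c p.1) + (-p.2.1) • jetEu (sqDist n x ∘ c.symm) (c p.1) +
        (p.2.2, 0, 0))) (x, 0, 0) := by
    rw [← h0] at hpar
    exact ContinuousAt.comp (f := fun p : M × ℝ × ℝ => ((c p.1, jetEu (f ∘ c.symm) (c p.1) +
      (-p.2.1) • jetEu (sqDist n x ∘ c.symm) (c p.1) + (p.2.2, 0, 0)) : Eu n × JetFibre n))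
      hpar hpair
  have hmem : ∀ᶠ p : M × ℝ × ℝ in 𝓝 (x, 0, 0), jetParam c (c p.1)
      (jetEu (f ∘ c.symm) (c p.1) + (-p.2.1) • jetEu (sqDist n x ∘ c.symm) (c p.1) +
        (p.2.2, 0, 0)) ∈ O := by
    refine hcomp.eventually (hO.mem_nhds ?_)
    have h1 : jetParam c (c x) (jetEu (f ∘ c.symm) (c x)) ∈ O := by
      rw [← jetAt_eq_jetParam hcm hxc hf]
      exact hx
    have h2 := congrArg Prod.snd h0
    simp only at h2 ⊢
    rw [h2]
    exact h1
  have hfst : Tendsto (fun p : M × ℝ × ℝ => p.1) (𝓝 (x, 0, 0)) (𝓝 x) := continuousAt_fst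
  filter_upwards [hmem, hfst.eventually (contMDiffAt_eventually hf),
    hfst.eventually (c.open_source.mem_nhds hxc)] with p h1 h2 h3
  rw [jetAt_perturb h2 h3]
  exact h1

/-! ### Positivity and negativity -/

theorem jetPull_sub_quad (D : Eu n →L[ℝ] Eu n) (B : Eu n →L[ℝ] Eu n →L[ℝ] Eu n) (j : JetFibre n)
    (Q : SymForm n) :
    jetPull D B (j - (0, 0, Q)) = jetPull D B j - (0, 0, symPart (quadPull D Q.1)) := by
  refine Prod.ext ?_ (Prod.ext ?_ ?_)
  · simp [jetPull]
  · simp [jetPull]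
  · refine symForm_ext fun v w => ?_
    change (symPart _).1 v w = (symPart _).1 v w - (symPart _).1 v w
    simp only [symPart_apply]
    change 1 / 2 * (((j.2.2.1 - Q.1) (D v) (D w) + (j.2.1 - 0) (B v w)) +
      ((j.2.2.1 - Q.1) (D w) (D v) + (j.2.1 - 0) (B w v))) =
      1 / 2 * ((j.2.2.1 (D v) (D w) + j.2.1 (B v w)) + (j.2.2.1 (D w) (D v) + j.2.1 (B w v))) -
      1 / 2 * (Q.1 (D v) (D w) + Q.1 (D w) (D v))
    simp only [_root_.sub_apply, _root_.sub_zero]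
    ring

theorem jetPull_add_const (D : Eu n →L[ℝ] Eu n) (B : Eu n →L[ℝ] Eu n →L[ℝ] Eu n) (j : JetFibre n)
    (c : ℝ) : jetPull D B (j + (c, 0, 0)) = jetPull D B j + (c, 0, 0) := by
  simp [jetPull]

theorem quadPull_quadPull (D D' : Eu n →L[ℝ] Eu n) (A : BilForm n) :
    quadPull D (quadPull D' A) = quadPull (D'.comp D) A := rfl

theorem symPart_quadPull_symPart (D : Eu n →L[ℝ] Eu n) (A : BilForm n) :
    symPart (quadPull D (symPart A).1) = symPart (quadPull D A) := by
  refine symForm_ext fun v w => ?_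
  simp only [symPart_apply, quadPull_apply]
  ring

/-- Adding a constant to the value commutes with every change of chart, so it is continuous on the
jet bundle. By (N), an open subset of `G` is moved to an open subset of `G`. -/
theorem interior_add_const {G : Set (JetBundle n M)} (hG : IsMonotone G) {x : M} {j : JetFibre n}
    {c : ℝ} (hc : c ≤ 0) (hj : (⟨x, j⟩ : JetBundle n M) ∈ interior G) :
    (⟨x, j + (c, 0, 0)⟩ : JetBundle n M) ∈ interior G := by
  refine mem_interior.2 ⟨{J | (⟨J.base, J.jet + (-c, 0, 0)⟩ : JetBundle n M) ∈ interior G},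
    fun J hJ => ?_, ?_, ?_⟩
  · have := hG.negativity J.base _ c hc (show _ ∈ G from interior_subset hJ)
    have h2 : J.jet + (-c, 0, 0) + (c, 0, 0) = J.jet := by
      refine Prod.ext ?_ (Prod.ext ?_ ?_) <;> simp
    rw [h2] at this
    exact this
  · rw [isOpen_jetBundle_iff]
    intro e he
    have hem := IsManifold.subset_maximalAtlas (I := 𝓡 n) (n := ∞) he
    have h1 := isOpen_jetBundle_iff.1 (isOpen_interior (s := G)) e he
    have h2 : Continuous fun q : e.target × JetFibre n =>
        ((q.1, q.2 + ((-c, 0, 0) : JetFibre n)) : e.target × JetFibre n) := by fun_prop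
    convert h1.preimage h2 using 1
    ext q
    simp only [mem_ofPred_eq, mem_preimage]
    rw [jetParam_eq hem q.1.2, jetParam_eq hem q.1.2, toPreferred, toPreferred, jetPull_add_const]
  · change (⟨x, j + (c, 0, 0) + (-c, 0, 0)⟩ : JetBundle n M) ∈ interior G
    have h2 : j + (c, 0, 0) + (-c, 0, 0) = j := by
      refine Prod.ext ?_ (Prod.ext ?_ ?_) <;> simp
    rwa [h2]

/-- The form `P` lives in one fibre only. It is extended to the section `Q` of nonnegative forms
that is constant in the chart at `x`, and adding this section moves interior points to interior
points. -/
theorem interior_add_pos {G : Set (JetBundle n M)} (hG : IsMonotone G) {x : M} {j : JetFibre n}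
    {P : SymForm n} (hP : ∀ v, 0 ≤ P.1 v v) (hj : (⟨x, j⟩ : JetBundle n M) ∈ interior G) :
    (⟨x, j + (0, 0, P)⟩ : JetBundle n M) ∈ interior G := by
  set c := chartAt (Eu n) x with hc
  have hxc : x ∈ c.source := mem_chart_source (Eu n) x
  have hcm : c ∈ IsManifold.maximalAtlas (𝓡 n) ∞ M := IsManifold.chart_mem_maximalAtlas x
  -- the section of forms which is constant in the chart `c`
  let D : M → Eu n →L[ℝ] Eu n := fun y =>
    fderiv ℝ (c ∘ (chartAt (Eu n) y).symm) (chartAt (Eu n) y y)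
  let Q : M → SymForm n := fun y => symPart (quadPull (D y) P.1)
  have hQpos : ∀ y v, 0 ≤ (Q y).1 v v := fun y v => by
    change 0 ≤ (symPart _).1 v v
    rw [symPart_apply, quadPull_apply]
    have := hP (D y v)
    linarith
  have hQx : Q x = P := by
    have h1 : c ∘ c.symm =ᶠ[𝓝 (c x)] id := by
      filter_upwards [c.open_target.mem_nhds (c.map_source hxc)] with z hz
      simp [c.right_inv hz]
    have h2 : D x = ContinuousLinearMap.id ℝ (Eu n) := by
      change fderiv ℝ (c ∘ c.symm) (c x) = _
      rw [h1.fderiv_eq, fderiv_id]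
    change symPart (quadPull (D x) P.1) = P
    rw [h2]
    exact symPart_of_symm P
  refine mem_interior.2 ⟨{J | J.base ∈ c.source ∧
    (⟨J.base, J.jet - (0, 0, Q J.base)⟩ : JetBundle n M) ∈ interior G}, fun J hJ => ?_, ?_, ?_⟩
  · have h1 := hG.positivity J.base _ (Q J.base) (hQpos _)
      (show _ ∈ G from interior_subset hJ.2)
    rw [sub_add_cancel] at h1
    exact h1
  · rw [isOpen_jetBundle_iff]
    intro e he
    have hem := IsManifold.subset_maximalAtlas (I := 𝓡 n) (n := ∞) he
    have h1 := isOpen_jetBundle_iff.1 (isOpen_interior (s := G)) e he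
    rw [isOpen_iff_mem_nhds]
    rintro ⟨⟨z, hz⟩, i⟩ ⟨hzc, hzi⟩
    change e.symm z ∈ c.source at hzc
    have hes := e.map_target hz
    let R : Eu n → SymForm n := fun z' => symPart (quadPull (fderiv ℝ (c ∘ e.symm) z') P.1)
    -- By the chain rule through the preferred chart at `e.symm z'`, subtracting `Q` amounts to
    -- subtracting `R` in the fixed chart `e`. Unlike the preferred chart, `R` is continuous.
    have key : ∀ z' ∈ e.target, e.symm z' ∈ c.source → ∀ i' : JetFibre n,
        (⟨(jetParam e z' i').base, (jetParam e z' i').jet -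
          (0, 0, Q (jetParam e z' i').base)⟩ : JetBundle n M) =
          jetParam e z' (i' - (0, 0, R z')) := by
      intro z' hz' hzc' i'
      have hes' := e.map_target hz'
      rw [jetParam_eq hem hz', jetParam_eq hem hz', toPreferred, toPreferred, jetPull_sub_quad]
      congr 4
      change symPart (quadPull (D (e.symm z')) P.1) = symPart (quadPull _ (symPart _).1)
      rw [symPart_quadPull_symPart, quadPull_quadPull]
      congr 2
      set y := e.symm z' with hy
      set d := chartAt (Eu n) y with hd
      have hyd : y ∈ d.source := mem_chart_source (Eu n) y
      have hdm : d ∈ IsManifold.maximalAtlas (𝓡 n) ∞ M := IsManifold.chart_mem_maximalAtlas y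
      have hval : (e ∘ d.symm) (d y) = z' := by
        rw [Function.comp_apply, d.left_inv hyd, hy, e.right_inv hz']
      have hσ : DifferentiableAt ℝ (e ∘ d.symm) (d y) :=
        (contDiffAt_transition hem hdm hes' hyd).differentiableAt (by simp)
      have hτ : DifferentiableAt ℝ (c ∘ e.symm) ((e ∘ d.symm) (d y)) := by
        rw [hval, ← e.right_inv hz']
        exact (contDiffAt_transition hcm hem hzc' hes').differentiableAt (by simp)
      have heq : c ∘ d.symm =ᶠ[𝓝 (d y)] (c ∘ e.symm) ∘ (e ∘ d.symm) := by
        have : ∀ᶠ w in 𝓝 (d y), d.symm w ∈ e.source :=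
          (d.continuousAt_symm (d.map_source hyd)).eventually
            (by rw [d.left_inv hyd]; exact e.open_source.mem_nhds hes')
        filter_upwards [this] with w hw
        simp [e.left_inv hw]
      change fderiv ℝ (c ∘ d.symm) (d y) = _
      rw [heq.fderiv_eq, fderiv_comp _ hτ hσ, hval]
    have hR : ContinuousAt R z := by
      have ht : ContDiffAt ℝ 2 (c ∘ e.symm) z := by
        have := contDiffAt_transition hcm hem hzc hes
        rwa [e.right_inv hz] at this
      have ht1 : ContDiffAt ℝ 1 (fderiv ℝ (c ∘ e.symm)) z := ht.fderiv_right (by norm_num)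
      exact (continuous_symPart.comp (continuous_quadPull P.1)).continuousAt.comp ht1.continuousAt
    have hmap : ContinuousAt (fun q : e.target × JetFibre n =>
        ((q.1, q.2 - ((0, 0, R q.1) : JetFibre n)) : e.target × JetFibre n)) (⟨z, hz⟩, i) := by
      have hz1 : ContinuousAt (fun q : e.target × JetFibre n => (q.1 : Eu n)) (⟨z, hz⟩, i) :=
        (continuous_subtype_val.comp continuous_fst).continuousAt
      have hR1 : ContinuousAt (fun q : e.target × JetFibre n => R q.1) (⟨z, hz⟩, i) :=
        ContinuousAt.comp (g := R) (f := fun q : e.target × JetFibre n => (q.1 : Eu n)) hR hz1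
      exact continuousAt_fst.prodMk
        (continuousAt_snd.sub (continuousAt_const.prodMk (continuousAt_const.prodMk hR1)))
    have hsrc : ∀ᶠ q : e.target × JetFibre n in 𝓝 (⟨z, hz⟩, i), e.symm q.1 ∈ c.source := by
      have hz1 : ContinuousAt (fun q : e.target × JetFibre n => (q.1 : Eu n)) (⟨z, hz⟩, i) :=
        (continuous_subtype_val.comp continuous_fst).continuousAt
      have : ContinuousAt (fun q : e.target × JetFibre n => e.symm q.1) (⟨z, hz⟩, i) :=
        ContinuousAt.comp (f := fun q : e.target × JetFibre n => (q.1 : Eu n))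
          (e.continuousAt_symm hz) hz1
      exact this.eventually (c.open_source.mem_nhds hzc)
    have hmem := hmap.eventually (h1.mem_nhds (by
      change jetParam e z (i - (0, 0, R z)) ∈ interior G
      rw [← key z hz hzc]
      exact hzi))
    filter_upwards [hsrc, hmem] with q h3 h4
    refine ⟨h3, ?_⟩
    have := key q.1 q.1.2 h3 q.2
    rw [this]
    exact h4
  · refine ⟨hxc, ?_⟩
    change (⟨x, j + (0, 0, P) - (0, 0, Q x)⟩ : JetBundle n M) ∈ interior G
    rw [hQx, add_sub_cancel_right]
    exact hj

/-- The dual is a negated complement of `interior G`, so the point is that the interior inherits (P)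
and (N). Only these two conditions are needed for barriers, which can thus be built for `F` and
`dual F` at once. -/
theorem IsMonotone.dual {G : Set (JetBundle n M)} (hG : IsMonotone G) :
    IsMonotone (DirichletDuality.dual G) where
  positivity x j P hP hj := by
    intro h
    refine hj ?_
    have := interior_add_pos hG hP h
    have h2 : -(j + (0, 0, P)) + (0, 0, P) = -j := by abel
    rwa [h2] at this
  negativity x j c hc hj := by
    intro h
    refine hj ?_
    have := interior_add_const hG hc h
    have h2 : -(j + (c, 0, 0)) + (c, 0, 0) = -j := by abel
    rwa [h2] at this

/-- A function touching from above a `C²` function with jet in `G` has its jet in `G`. -/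
theorem IsMonotone.jetAt_mem_of_touch {G : Set (JetBundle n M)} (hG : IsMonotone G) {x : M}
    {f ψ : M → ℝ} (hf : ContMDiffAt (𝓡 n) 𝓘(ℝ, ℝ) 2 f x) (hψ : ContMDiffAt (𝓡 n) 𝓘(ℝ, ℝ) 2 ψ x)
    (hle : ∀ᶠ y in 𝓝 x, f y ≤ ψ y) (heq : f x = ψ x) (hx : jetAt f x ∈ G) : jetAt ψ x ∈ G := by
  set c := chartAt (Eu n) x with hc
  have hxc : x ∈ c.source := mem_chart_source (Eu n) x
  have hcm : c ∈ IsManifold.maximalAtlas (𝓡 n) ∞ M := IsManifold.chart_mem_maximalAtlas x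
  have h1 := contDiffAt_comp_symm hcm hxc hf
  have h2 := contDiffAt_comp_symm hcm hxc hψ
  have h3 : ContDiffAt ℝ 2 (fun z => (-1) * (f ∘ c.symm) z) (c x) := contDiffAt_const.mul h1
  obtain ⟨P, hP, hjet⟩ := jetEu_of_isLocalMin
    (h := fun z => (ψ ∘ c.symm) z + (-1) * (f ∘ c.symm) z) (h2.add h3)
    (by simp [c.left_inv hxc, heq])
    (by
      have ht : Tendsto c.symm (𝓝 (c x)) (𝓝 x) := by
        have := c.continuousAt_symm (c.map_source hxc)
        rwa [ContinuousAt, c.left_inv hxc] at this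
      filter_upwards [ht.eventually hle] with z hz
      simp only [Function.comp_apply]
      linarith)
  rw [jetEu_add h2 h3, jetEu_const_mul _ h1] at hjet
  have h4 : jetEu (ψ ∘ c.symm) (c x) = jetEu (f ∘ c.symm) (c x) + (0, 0, P) := by
    rw [← hjet]
    refine Prod.ext (by simp) (Prod.ext ?_ (by simp))
    ext v
    simp
  rw [jetAt_eq] at hx ⊢
  rw [← hc, h4]
  exact hG.positivity x _ P hP hx

end JetTopology

/-! ### The boundary of a domain with corners -/

section Corners

variable {n : ℕ} {M : Type*} [TopologicalSpace M] {U : Set M} {x : M}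
  {e : OpenPartialHomeomorph M (Eu n)} {s : Finset (Fin n)}

/-- The vector with coordinates `1` in `s \ {i}` and `0` elsewhere. -/
def inwardVec (s : Finset (Fin n)) (i : Fin n) : Eu n :=
  WithLp.toLp 2 fun k => if k ∈ s ∧ k ≠ i then 1 else 0

theorem inwardVec_self (s : Finset (Fin n)) (i : Fin n) : inwardVec s i i = 0 := by
  simp [inwardVec]

theorem inwardVec_of_mem {s : Finset (Fin n)} {i k : Fin n} (hk : k ∈ s) (hki : k ≠ i) :
    inwardVec s i k = 1 := by
  simp [inwardVec, hk, hki]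

/-- The points of the `i`-th sheet of the boundary, off the other sheets, in a coordinate ball. -/
def sheet (e : OpenPartialHomeomorph M (Eu n)) (x : M) (s : Finset (Fin n)) (i : Fin n) (ε : ℝ) :
    Set M :=
  e.symm '' {z | z ∈ Metric.ball (e x) ε ∧ z i = 0 ∧ ∀ k ∈ s, k ≠ i → 0 < z k}

theorem sheet_mono (i : Fin n) {ε ε' : ℝ} (h : ε ≤ ε') : sheet e x s i ε ⊆ sheet e x s i ε' :=
  image_mono fun _ hz => ⟨Metric.ball_subset_ball h hz.1, hz.2⟩

/-- In the chart a sheet is the convex intersection of a ball, a hyperplane and open half-spaces. It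
therefore selects a single component of the depth-one points near `x`. -/
theorem isPreconnected_sheet (i : Fin n) {ε : ℝ} (hε : Metric.ball (e x) ε ⊆ e.target) :
    IsPreconnected (sheet e x s i ε) := by
  refine IsPreconnected.image ?_ _ (e.continuousOn_symm.mono fun z hz => hε hz.1)
  refine Convex.isPreconnected ?_
  refine (convex_ball _ _).inter ?_
  intro z hz w hw a b ha hb hab
  refine ⟨by simp [hz.1, hw.1], fun k hk hki => ?_⟩
  have h1 := hz.2 k hk hki
  have h2 := hw.2 k hk hki
  simp only [PiLp.add_apply, PiLp.smul_apply, smul_eq_mul]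
  rcases ha.eq_or_lt with rfl | ha'
  · have : b = 1 := by linarith
    simp [this, h2]
  · have := mul_pos ha' h1
    have := mul_nonneg hb h2.le
    linarith

theorem exists_pos_add_smul_mem_ball (z w v : Eu n) {ε : ℝ} (hz : z ∈ Metric.ball w ε) :
    ∃ τ > 0, ∀ t ∈ Icc (0 : ℝ) τ, z + t • v ∈ Metric.ball w ε := by
  have h1 : Tendsto (fun t : ℝ => z + t • v) (𝓝 0) (𝓝 z) := by
    have : Continuous fun t : ℝ => z + t • v := by fun_prop
    simpa using this.tendsto 0
  obtain ⟨r, hr, h2⟩ := Metric.eventually_nhds_iff.1 (h1.eventually (Metric.isOpen_ball.mem_nhds hz))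
  refine ⟨r / 2, by positivity, fun t ht => h2 ?_⟩
  rw [Real.dist_eq, sub_zero, abs_of_nonneg ht.1]
  linarith [ht.2]

theorem exists_ball_of_mem_nhds (hx : x ∈ e.source) {V : Set M} (hV : V ∈ 𝓝 x) :
    ∃ ε > 0, Metric.ball (e x) ε ⊆ e.target ∧ ∀ z ∈ Metric.ball (e x) ε, e.symm z ∈ V := by
  have h1 : ∀ᶠ z in 𝓝 (e x), z ∈ e.target ∧ e.symm z ∈ V :=
    Filter.Eventually.and (e.open_target.mem_nhds (e.map_source hx))
      ((e.continuousAt_symm (e.map_source hx)).eventually (by rwa [e.left_inv hx]))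
  obtain ⟨ε, hε, h⟩ := Metric.eventually_nhds_iff.1 h1
  exact ⟨ε, hε, fun z hz => (h hz).1, fun z hz => (h hz).2⟩

variable [ChartedSpace (Eu n) M]

theorem IsCornerChart.sheet_nonempty (hc : IsCornerChart U x e s) {i : Fin n} (hi : i ∈ s) {ε : ℝ}
    (hε : 0 < ε) : (sheet e x s i ε).Nonempty := by
  obtain ⟨τ, hτ, h⟩ := exists_pos_add_smul_mem_ball (e x) (e x) (inwardVec s i)
    (Metric.mem_ball_self hε)
  refine ⟨_, mem_image_of_mem _ ⟨h τ (right_mem_Icc.2 hτ.le), ?_, fun k hk hki => ?_⟩⟩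
  · simp [inwardVec_self, hc.apply_eq_zero i hi]
  · simp [inwardVec_of_mem hk hki, hc.apply_eq_zero k hk, hτ]

/-- Restricting `e` to the open set where the coordinates in `s` other than `i` are positive leaves
a corner chart with `{i}` as its set of vanishing coordinates. -/
theorem IsCornerChart.sheet_subset_depthOne (hc : IsCornerChart U x e s) {i : Fin n} (hi : i ∈ s)
    {ε : ℝ} (hε : Metric.ball (e x) ε ⊆ e.target) : sheet e x s i ε ⊆ depthOne n U := by
  rintro _ ⟨z, ⟨hz, hzi, hzk⟩, rfl⟩
  have hzt := hε hz
  set O : Set (Eu n) := ⋂ k ∈ s.erase i, {w | 0 < w k} with hO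
  have hOo : IsOpen O := by
    refine isOpen_biInter_finset fun k _ => ?_
    exact isOpen_lt continuous_const (by fun_prop)
  have hmemO : ∀ w, w ∈ O ↔ ∀ k ∈ s, k ≠ i → 0 < w k := by
    intro w
    simp only [hO, mem_iInter, Finset.mem_erase, mem_ofPred_eq]
    exact ⟨fun h k hk hki => h k ⟨hki, hk⟩, fun h k hk => h k hk.2 hk.1⟩
  have hN : IsOpen (e.source ∩ e ⁻¹' O) := e.isOpen_inter_preimage hOo
  have hsrc : ∀ y, y ∈ (e.restr (e.source ∩ e ⁻¹' O)).source ↔ y ∈ e.source ∧ e y ∈ O := by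
    intro y
    rw [e.restr_source, hN.interior_eq]
    simp
  refine ⟨e.restr (e.source ∩ e ⁻¹' O), {i}, ?_, Finset.card_singleton i⟩
  refine ⟨?_, ?_, ?_, ?_, ?_⟩
  · exact restr_mem_maximalAtlas _ hc.mem_maximalAtlas hN
  · rw [hsrc, e.right_inv hzt, hmemO]
    exact ⟨e.map_target hzt, hzk⟩
  · intro k hk
    rw [Finset.mem_singleton.1 hk]
    simpa [e.right_inv hzt] using hzi
  · intro y hy
    rw [hsrc, hmemO] at hy
    rw [hc.mem_closure_iff y hy.1]
    refine ⟨fun h k hk => by rw [Finset.mem_singleton.1 hk]; exact h i hi, fun h k hk => ?_⟩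
    by_cases hki : k = i
    · rw [hki]
      exact h i (Finset.mem_singleton_self i)
    · exact (hy.2 k hk hki).le
  · intro y hy
    rw [hsrc, hmemO] at hy
    rw [hc.mem_iff y hy.1]
    refine ⟨fun h k hk => by rw [Finset.mem_singleton.1 hk]; exact h i hi, fun h k hk => ?_⟩
    by_cases hki : k = i
    · rw [hki]
      exact h i (Finset.mem_singleton_self i)
    · exact hy.2 k hk hki

theorem IsCornerChart.exists_sheet_subset (hc : IsCornerChart U x e s)
    (V : TopologicalSpace.OpenNhdsOf x) :
    ∃ ε > 0, Metric.ball (e x) ε ⊆ e.target ∧ ∀ z ∈ Metric.ball (e x) ε, e.symm z ∈ (V : Set M) :=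
  exists_ball_of_mem_nhds hc.mem_source (V.isOpen.mem_nhds V.mem)

theorem IsCornerChart.sheet_subset_inter (hc : IsCornerChart U x e s) {i : Fin n} (hi : i ∈ s)
    {V : Set M} {ε : ℝ} (hε : Metric.ball (e x) ε ⊆ e.target)
    (hV : ∀ z ∈ Metric.ball (e x) ε, e.symm z ∈ V) : sheet e x s i ε ⊆ V ∩ depthOne n U := by
  refine subset_inter ?_ (hc.sheet_subset_depthOne hi hε)
  rintro _ ⟨z, hz, rfl⟩
  exact hV z hz.1

/-- The boundary point over `x` given by the `i`-th sheet. -/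
def IsCornerChart.sheetPoint (hc : IsCornerChart U x e s) {i : Fin n} (hi : i ∈ s) :
    CornerBoundary n U where
  pt := x
  comp V := connectedComponentIn ((V : Set M) ∩ depthOne n U)
    (hc.sheet_nonempty hi (hc.exists_sheet_subset V).choose_spec.1).some
  comp_isComponent V := by
    have h := (hc.exists_sheet_subset V).choose_spec
    exact ⟨_, hc.sheet_subset_inter hi h.2.1 h.2.2 (hc.sheet_nonempty hi h.1).some_mem, rfl⟩
  comp_mono V V' hVV' := by
    have h := (hc.exists_sheet_subset V).choose_spec
    have h' := (hc.exists_sheet_subset V').choose_spec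
    have hS := hc.sheet_subset_inter hi h.2.1 fun z hz => hVV' (h.2.2 z hz)
    have hS' := hc.sheet_subset_inter hi h'.2.1 h'.2.2
    have hm := (hc.sheet_nonempty hi h.1).some_mem
    have hm' := (hc.sheet_nonempty hi h'.1).some_mem
    refine (connectedComponentIn_mono _ (inter_subset_inter_left _ hVV')).trans ?_
    refine (connectedComponentIn_eq ?_).le
    -- The base points were chosen in balls of unrelated radii. The smaller sheet lies in the larger
    -- one, whose connectedness joins the two base points.
    rcases le_total (hc.exists_sheet_subset V).choose (hc.exists_sheet_subset V').choose with hle | hle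
    · exact (isPreconnected_sheet i h'.2.1).subset_connectedComponentIn (sheet_mono i hle hm) hS' hm'
    · exact (isPreconnected_sheet i h.2.1).subset_connectedComponentIn hm hS (sheet_mono i hle hm')

/-- This frees `sheetPoint` from the radius chosen in its definition: any admissible radius gives
the same component. -/
theorem IsCornerChart.sheet_subset_comp (hc : IsCornerChart U x e s) {i : Fin n} (hi : i ∈ s)
    (V : TopologicalSpace.OpenNhdsOf x) {ε : ℝ} (hε : Metric.ball (e x) ε ⊆ e.target)
    (hV : ∀ z ∈ Metric.ball (e x) ε, e.symm z ∈ (V : Set M)) :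
    sheet e x s i ε ⊆ (hc.sheetPoint hi).comp V := by
  have h := (hc.exists_sheet_subset V).choose_spec
  have hm := (hc.sheet_nonempty hi h.1).some_mem
  change _ ⊆ connectedComponentIn ((V : Set M) ∩ depthOne n U)
    (hc.sheet_nonempty hi h.1).some
  rcases le_total (hc.exists_sheet_subset V).choose ε with hle | hle
  · exact (isPreconnected_sheet i hε).subset_connectedComponentIn (sheet_mono i hle hm)
      (hc.sheet_subset_inter hi hε hV)
  · exact (sheet_mono i hle).trans ((isPreconnected_sheet i h.2.1).subset_connectedComponentIn hm
      (hc.sheet_subset_inter hi h.2.1 h.2.2))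

/-! ### Local boundary components and the topology of `∂U`. -/

theorem CornerBoundary.comp_subset (b : CornerBoundary n U)
    (V : TopologicalSpace.OpenNhdsOf b.pt) : b.comp V ⊆ (V : Set M) ∩ depthOne n U := by
  obtain ⟨y, _, h⟩ := b.comp_isComponent V
  rw [h]
  exact connectedComponentIn_subset _ _

theorem CornerBoundary.comp_nonempty (b : CornerBoundary n U)
    (V : TopologicalSpace.OpenNhdsOf b.pt) : (b.comp V).Nonempty := by
  obtain ⟨y, hy, h⟩ := b.comp_isComponent V
  rw [h]
  exact ⟨y, mem_connectedComponentIn hy⟩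

/-- Local boundary components of the same neighbourhood which meet are equal. -/
theorem CornerBoundary.comp_eq_of_mem (b b' : CornerBoundary n U) {V : TopologicalSpace.Opens M}
    (h : b.pt ∈ V) (h' : b'.pt ∈ V) {y : M} (hy : y ∈ b.comp ⟨V, h⟩) (hy' : y ∈ b'.comp ⟨V, h'⟩) :
    b.comp ⟨V, h⟩ = b'.comp ⟨V, h'⟩ := by
  obtain ⟨w, _, hw⟩ := b.comp_isComponent ⟨V, h⟩
  obtain ⟨w', _, hw'⟩ := b'.comp_isComponent ⟨V, h'⟩
  rw [hw] at hy ⊢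
  rw [hw'] at hy' ⊢
  exact (connectedComponentIn_eq hy).trans (connectedComponentIn_eq hy').symm

/-- The common component for the smaller neighbourhood is non-empty and lies in both components for
the larger one, which therefore meet and coincide. -/
theorem CornerBoundary.comp_eq_of_subset (b b' : CornerBoundary n U)
    {V V' : TopologicalSpace.Opens M} (hVV' : V ≤ V') (h : b.pt ∈ V) (h' : b'.pt ∈ V)
    (heq : b.comp ⟨V, h⟩ = b'.comp ⟨V, h'⟩) :
    b.comp ⟨V', hVV' h⟩ = b'.comp ⟨V', hVV' h'⟩ := by
  obtain ⟨y, hy⟩ := b.comp_nonempty ⟨V, h⟩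
  refine b.comp_eq_of_mem b' _ _ (b.comp_mono ⟨V, h⟩ ⟨V', hVV' h⟩ hVV' hy) ?_
  rw [heq] at hy
  exact b'.comp_mono ⟨V, h'⟩ ⟨V', hVV' h'⟩ hVV' hy

/-- The generating sets of the topology form a basis: for an intersection, equality of components on
`V₁ ⊓ V₂` propagates to `V₁` and to `V₂`. -/
theorem CornerBoundary.exists_opens_of_isOpen {N : Set (CornerBoundary n U)} (hN : IsOpen N)
    {b : CornerBoundary n U} (hb : b ∈ N) :
    ∃ (V : TopologicalSpace.Opens M) (h : b.pt ∈ V), ∀ (b' : CornerBoundary n U) (h' : b'.pt ∈ V),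
      b'.comp ⟨V, h'⟩ = b.comp ⟨V, h⟩ → b' ∈ N := by
  have hN' : TopologicalSpace.GenerateOpen _ N := hN
  induction hN' with
  | basic N hg =>
    obtain ⟨V, W, rfl⟩ : ∃ (V : TopologicalSpace.Opens M) (W : Set M),
      N = {b : CornerBoundary n U | ∃ h : b.pt ∈ V, b.comp ⟨V, h⟩ = W} := hg
    obtain ⟨h, hW⟩ : ∃ h : b.pt ∈ V, b.comp ⟨V, h⟩ = W := hb
    exact ⟨V, h, fun b' h' heq => ⟨h', heq.trans hW⟩⟩
  | univ => exact ⟨⊤, trivial, fun _ _ _ => trivial⟩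
  | inter N₁ N₂ h₁ h₂ ih₁ ih₂ =>
    obtain ⟨V₁, hV₁, H₁⟩ := ih₁ h₁ hb.1
    obtain ⟨V₂, hV₂, H₂⟩ := ih₂ h₂ hb.2
    exact ⟨V₁ ⊓ V₂, ⟨hV₁, hV₂⟩, fun b' h' heq =>
      ⟨H₁ b' h'.1 (b'.comp_eq_of_subset b inf_le_left h' ⟨hV₁, hV₂⟩ heq),
        H₂ b' h'.2 (b'.comp_eq_of_subset b inf_le_right h' ⟨hV₁, hV₂⟩ heq)⟩⟩
  | sUnion S hS ih =>
    obtain ⟨N, hNS, hbN⟩ := hb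
    obtain ⟨V, h, H⟩ := ih N hNS (hS N hNS) hbN
    exact ⟨V, h, fun b' h' heq => ⟨N, hNS, H b' h' heq⟩⟩

theorem notMem_of_mem_depthOne {y : M} (hy : y ∈ depthOne n U) : y ∈ closure U ∧ y ∉ U := by
  obtain ⟨e, s, hc, hs⟩ := hy
  obtain ⟨i, rfl⟩ := Finset.card_eq_one.1 hs
  have h0 := hc.apply_eq_zero i (Finset.mem_singleton_self i)
  rw [hc.mem_closure_iff y hc.mem_source, hc.mem_iff y hc.mem_source]
  simp [h0]

/-- Every boundary point near `x` lies near one of the boundary points over `x`. -/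
theorem IsCornerChart.exists_comp_eq (hc : IsCornerChart U x e s) {ε : ℝ}
    {V : TopologicalSpace.OpenNhdsOf x} (hε : Metric.ball (e x) ε ⊆ e.target)
    (hV : (V : Set M) = e.symm '' Metric.ball (e x) ε) (b : CornerBoundary n U)
    (hb : b.pt ∈ V.1) :
    ∃ (i : Fin n) (hi : i ∈ s), b.comp ⟨V.1, hb⟩ = (hc.sheetPoint hi).comp V := by
  have hVm : ∀ z ∈ Metric.ball (e x) ε, e.symm z ∈ (V : Set M) := fun z hz => by
    rw [hV]
    exact mem_image_of_mem _ hz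
  obtain ⟨y, ⟨hyV, hy1⟩, hcomp⟩ := b.comp_isComponent ⟨V.1, hb⟩
  change y ∈ (V : Set M) at hyV
  rw [hV] at hyV
  obtain ⟨z, hz, rfl⟩ := hyV
  have hzt := hε hz
  obtain ⟨hycl, hyU⟩ := notMem_of_mem_depthOne hy1
  rw [hc.mem_closure_iff _ (e.map_target hzt), e.right_inv hzt] at hycl
  rw [hc.mem_iff _ (e.map_target hzt), e.right_inv hzt] at hyU
  push Not at hyU
  obtain ⟨i, hi, hzi⟩ := hyU
  have hzi0 : z i = 0 := le_antisymm hzi (hycl i hi)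
  -- Moving from `z` along `inwardVec s i` makes all other coordinates in `s` positive while keeping
  -- `z i = 0`. The segment starts in the component of `b` and lies in the `i`-th sheet for `t > 0`.
  -- Whether further coordinates of `z` vanish need not be decided: at `t = 0` membership in
  -- `depthOne` is already known.
  obtain ⟨τ, hτ, hseg⟩ := exists_pos_add_smul_mem_ball z (e x) (inwardVec s i) hz
  have hsheet : ∀ t ∈ Ioc (0 : ℝ) τ, e.symm (z + t • inwardVec s i) ∈ sheet e x s i ε := by
    intro t ht
    refine mem_image_of_mem _ ⟨hseg t ⟨ht.1.le, ht.2⟩, ?_, fun k hk hki => ?_⟩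
    · simp [inwardVec_self, hzi0]
    · simp only [PiLp.add_apply, PiLp.smul_apply, inwardVec_of_mem hk hki, smul_eq_mul, mul_one]
      linarith [hycl k hk, ht.1]
  have hpath : IsPreconnected ((fun t : ℝ => e.symm (z + t • inwardVec s i)) '' Icc 0 τ) := by
    refine isPreconnected_Icc.image _ ?_
    refine e.continuousOn_symm.comp (Continuous.continuousOn (by fun_prop)) ?_
    exact fun t ht => hε (hseg t ht)
  have hsub : (fun t : ℝ => e.symm (z + t • inwardVec s i)) '' Icc 0 τ ⊆
      (V : Set M) ∩ depthOne n U := by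
    rintro _ ⟨t, ht, rfl⟩
    refine ⟨hVm _ (hseg t ht), ?_⟩
    rcases ht.1.eq_or_lt with rfl | ht0
    · simpa using hy1
    · exact hc.sheet_subset_depthOne hi hε (hsheet t ⟨ht0, ht.2⟩)
  have hmem0 : e.symm z ∈ (fun t : ℝ => e.symm (z + t • inwardVec s i)) '' Icc 0 τ :=
    ⟨0, left_mem_Icc.2 hτ.le, by simp⟩
  have hmem1 : e.symm (z + τ • inwardVec s i) ∈ b.comp ⟨V.1, hb⟩ := by
    rw [hcomp]
    exact hpath.subset_connectedComponentIn hmem0 hsub ⟨τ, right_mem_Icc.2 hτ.le, rfl⟩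
  refine ⟨i, hi, b.comp_eq_of_mem (hc.sheetPoint hi) hb V.2 hmem1 ?_⟩
  exact hc.sheet_subset_comp hi V hε hVm (hsheet τ (right_mem_Ioc.2 hτ))

/-! ### The corner boundary and the topological boundary. -/

theorem ClosureHasCorners.exists_boundary_point (hU : ClosureHasCorners n U) (hx : x ∈ closure U)
    (hxU : x ∉ U) : ∃ b : CornerBoundary n U, b.pt = x := by
  obtain ⟨e, s, hc⟩ := hU x hx
  rw [hc.mem_iff x hc.mem_source] at hxU
  push Not at hxU
  obtain ⟨i, hi, -⟩ := hxU
  exact ⟨hc.sheetPoint hi, rfl⟩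

theorem CornerBoundary.pt_mem (b : CornerBoundary n U) : b.pt ∈ closure (closure U \ U) := by
  rw [mem_closure_iff]
  intro O hO hb
  obtain ⟨y, hy⟩ := b.comp_nonempty ⟨⟨O, hO⟩, hb⟩
  have := b.comp_subset _ hy
  exact ⟨y, this.1, notMem_of_mem_depthOne this.2⟩

theorem CornerBoundary.pt_mem_diff (hUo : IsOpen U) (b : CornerBoundary n U) :
    b.pt ∈ closure U \ U := by
  have hcl : IsClosed (closure U \ U) := isClosed_closure.sdiff hUo
  have := b.pt_mem
  rwa [hcl.closure_eq] at this

/-- At a point of `closure U` outside `U` some coordinate in `s` vanishes, and an arbitrarily short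
move against this coordinate leaves `closure U`. -/
theorem ClosureHasCorners.interior_closure (hU : ClosureHasCorners n U) (hUo : IsOpen U) :
    interior (closure U) = U := by
  refine Subset.antisymm (fun x hx => ?_) (interior_maximal subset_closure hUo)
  by_contra hxU
  obtain ⟨e, s, hc⟩ := hU x (interior_subset hx)
  rw [hc.mem_iff x hc.mem_source] at hxU
  push Not at hxU
  obtain ⟨i, hi, -⟩ := hxU
  obtain ⟨ε, hε, ht, hV⟩ := exists_ball_of_mem_nhds hc.mem_source
    (isOpen_interior.mem_nhds hx)
  obtain ⟨τ, hτ, h⟩ := exists_pos_add_smul_mem_ball (e x) (e x) (-EuclideanSpace.single i (1 : ℝ))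
    (Metric.mem_ball_self hε)
  have h1 := h τ (right_mem_Icc.2 hτ.le)
  have h2 := interior_subset (hV _ h1)
  rw [hc.mem_closure_iff _ (e.map_target (ht h1)), e.right_inv (ht h1)] at h2
  have h3 := h2 i hi
  simp [hc.apply_eq_zero i hi] at h3
  linarith

theorem ClosureHasCorners.frontier_closure (hU : ClosureHasCorners n U) (hUo : IsOpen U) :
    frontier (closure U) = closure U \ U := by
  rw [isClosed_closure.frontier_eq, hU.interior_closure hUo]

/-- A continuous consistent function on `∂U` is continuous as a function on the image of `∂U`. -/
theorem ClosureHasCorners.eventually_abs_sub_lt (hU : ClosureHasCorners n U) (hUo : IsOpen U)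
    {φ : CornerBoundary n U → ℝ} (hφ : Continuous φ) (hφc : Consistent φ) (b : CornerBoundary n U)
    {δ : ℝ} (hδ : 0 < δ) :
    ∀ᶠ y in 𝓝 b.pt, ∀ b' : CornerBoundary n U, b'.pt = y → |φ b' - φ b| < δ := by
  obtain ⟨e, s, hc⟩ := hU b.pt (b.pt_mem_diff hUo).1
  have hN : IsOpen {b' | |φ b' - φ b| < δ} :=
    isOpen_lt (continuous_abs.comp (hφ.sub continuous_const)) continuous_const
  -- Consistency enters here: the finitely many boundary points over `b.pt` given by the sheets all
  -- carry the value `φ b`. Every boundary point nearby selects the component of one of these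
  -- sheets.
  have hsp : ∀ i : s, φ (hc.sheetPoint i.2) = φ b := fun i => hφc _ _ rfl
  have hex : ∀ i : s, ∃ (V : TopologicalSpace.Opens M) (h : b.pt ∈ V),
      ∀ (b' : CornerBoundary n U) (h' : b'.pt ∈ V),
        b'.comp ⟨V, h'⟩ = (hc.sheetPoint i.2).comp ⟨V, h⟩ → |φ b' - φ b| < δ := fun i =>
    CornerBoundary.exists_opens_of_isOpen hN (b := hc.sheetPoint i.2) (by
      change |φ _ - φ b| < δ
      rw [hsp i]
      simpa using hδ)
  choose V hV hVφ using hex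
  have hnhds : (⋂ i : s, (V i : Set M)) ∈ 𝓝 b.pt :=
    iInter_mem.2 fun i => (V i).2.mem_nhds (hV i)
  obtain ⟨ε, hε, ht, hsub⟩ := exists_ball_of_mem_nhds hc.mem_source hnhds
  have hopen : IsOpen (e.symm '' Metric.ball (e b.pt) ε) :=
    e.symm.isOpen_image_of_subset_source Metric.isOpen_ball ht
  have hmem : b.pt ∈ e.symm '' Metric.ball (e b.pt) ε :=
    ⟨e b.pt, Metric.mem_ball_self hε, e.left_inv hc.mem_source⟩
  let W : TopologicalSpace.OpenNhdsOf b.pt := ⟨⟨_, hopen⟩, hmem⟩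
  filter_upwards [hopen.mem_nhds hmem] with y hy b' hb'
  subst hb'
  obtain ⟨i, hi, hcomp⟩ := hc.exists_comp_eq (V := W) ht rfl b' hy
  have hle : W.1 ≤ V ⟨i, hi⟩ := by
    rintro _ ⟨z, hz, rfl⟩
    exact mem_iInter.1 (hsub z hz) ⟨i, hi⟩
  exact hVφ ⟨i, hi⟩ b' (hle hy) (b'.comp_eq_of_subset (hc.sheetPoint hi) hle hy W.2 hcomp)

/-- A local defining function of a sheet through `b` is smooth near `b`, vanishes at `b` and is
negative on `U`. -/
theorem IsDefiningFunctionNear.basic {b : CornerBoundary n U} {ρ : M → ℝ} (hUo : IsOpen U)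
    (h : IsDefiningFunctionNear b ρ) :
    ContMDiffAt (𝓡 n) 𝓘(ℝ, ℝ) 2 ρ b.pt ∧ ρ b.pt = 0 ∧ ∀ᶠ y in 𝓝 b.pt, y ∈ U → ρ y < 0 := by
  obtain ⟨V, h1, h2, h3, -⟩ := h
  have hV : (V : Set M) ∈ 𝓝 b.pt := V.isOpen.mem_nhds V.mem
  refine ⟨((h1.contMDiffAt hV).of_le (ENat.LEInfty.out (m := 2))), ?_, ?_⟩
  · rw [h3 b.pt V.mem (b.pt_mem_diff hUo).1, mem_closure_iff]
    intro O hO hb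
    -- The component for the smaller neighbourhood `O ∩ V` is contained in `b.comp V`, so `b.pt` is
    -- a limit of points of `b.comp V`.
    obtain ⟨y, hy⟩ := b.comp_nonempty (⟨⟨O, hO⟩, hb⟩ ⊓ V)
    exact ⟨y, (b.comp_subset _ hy).1.1, b.comp_mono _ V inter_subset_right hy⟩
  · filter_upwards [hV] with y hy using h2 y hy

end Corners

/-! ### Upper semicontinuous functions with values in the extended reals -/

section EReal

theorem add_coe_le_coe_iff {a : EReal} {r s : ℝ} :
    a + (r : EReal) ≤ (s : EReal) ↔ a ≤ ((s - r : ℝ) : EReal) := by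
  induction a with
  | bot => simp
  | top =>
    rw [EReal.top_add_coe]
    exact iff_of_false (EReal.coe_lt_top _).not_ge (EReal.coe_lt_top _).not_ge
  | coe a =>
    norm_cast
    exact le_sub_iff_add_le.symm

theorem add_coe_eq_coe_iff {a : EReal} {r s : ℝ} :
    a + (r : EReal) = (s : EReal) ↔ a = ((s - r : ℝ) : EReal) := by
  induction a with
  | bot =>
    rw [EReal.bot_add]
    exact iff_of_false (EReal.bot_lt_coe _).ne (EReal.bot_lt_coe _).ne
  | top =>
    rw [EReal.top_add_coe]
    exact iff_of_false (EReal.coe_lt_top _).ne' (EReal.coe_lt_top _).ne'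
  | coe a =>
    norm_cast
    exact eq_sub_iff_add_eq.symm

variable {M : Type*}

open Classical in
/-- Extension of a function on `V` by `-∞`. -/
def extendBot (V : Set M) (f : M → EReal) (y : M) : EReal := if y ∈ V then f y else ⊥

theorem extendBot_of_mem {V : Set M} (f : M → EReal) {y : M} (hy : y ∈ V) :
    extendBot V f y = f y := if_pos hy

theorem extendBot_of_notMem {V : Set M} (f : M → EReal) {y : M} (hy : y ∉ V) :
    extendBot V f y = ⊥ := if_neg hy

theorem extendBot_le {V : Set M} {f : M → EReal} {y : M} {a : EReal} (h : y ∈ V → f y ≤ a) :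
    extendBot V f y ≤ a := by
  by_cases hy : y ∈ V
  · rw [extendBot_of_mem f hy]
    exact h hy
  · rw [extendBot_of_notMem f hy]
    exact bot_le

variable [TopologicalSpace M]

theorem upperSemicontinuousOn_add_coe {u : M → EReal} {θ : M → ℝ} {K : Set M}
    (hu : UpperSemicontinuousOn u K) (hθ : ContinuousOn θ K) :
    UpperSemicontinuousOn (fun y => u y + (θ y : EReal)) K := by
  intro x hx
  have hθ' : ContinuousOn (fun y => (θ y : EReal)) K :=
    continuous_coe_real_ereal.comp_continuousOn hθ
  exact UpperSemicontinuousWithinAt.add' (hu x hx) (hθ'.upperSemicontinuousOn x hx)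
    (EReal.continuousAt_add (Or.inr (EReal.coe_ne_bot _)) (Or.inr (EReal.coe_ne_top _)))

/-! ### Upper semicontinuous regularization. -/

/-- The upper semicontinuous regularization of the restriction of a function to a set. -/
def uscHull (K : Set M) (f : M → EReal) (x : M) : EReal := limsup f (𝓝[K] x)

/-- The filter `𝓝[K] x` is not punctured, so the value at `x` itself counts in the upper limit. -/
theorem le_uscHull {K : Set M} {f : M → EReal} {x : M} (hx : x ∈ K) : f x ≤ uscHull K f x :=
  le_limsup_of_frequently_le' <| by
    intro h
    exact (h.self_of_nhdsWithin hx) le_rfl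

theorem uscHull_le {K : Set M} {f : M → EReal} {x : M} {a : EReal}
    (h : ∀ᶠ y in 𝓝[K] x, f y ≤ a) : uscHull K f x ≤ a :=
  limsup_le_of_le (by isBoundedDefault) h

theorem uscHull_le_coe {K : Set M} {f : M → EReal} {θ : M → ℝ} {x : M}
    (hθ : ContinuousWithinAt θ K x) (h : ∀ᶠ y in 𝓝[K] x, f y ≤ (θ y : EReal)) :
    uscHull K f x ≤ (θ x : EReal) := by
  refine le_of_forall_gt_imp_ge_of_dense fun a ha => ?_
  have h1 : ContinuousWithinAt (fun y => (θ y : EReal)) K x :=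
    continuous_coe_real_ereal.continuousAt.comp_continuousWithinAt hθ
  refine uscHull_le ?_
  filter_upwards [h, h1.eventually (gt_mem_nhds ha)] with y h2 h3 using h2.trans h3.le

theorem upperSemicontinuousOn_uscHull (K : Set M) (f : M → EReal) :
    UpperSemicontinuousOn (uscHull K f) K := by
  intro x _ a ha
  obtain ⟨b, hb, hba⟩ := exists_between ha
  have h1 : ∀ᶠ y in 𝓝[K] x, f y < b := eventually_lt_of_limsup_lt hb
  filter_upwards [eventually_eventually_nhdsWithin.2 h1] with y hy
  exact (uscHull_le (hy.mono fun _ h => h.le)).trans_lt hba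

/-- A criterion for the upper semicontinuity of a supremum of functions extended by `-∞`. -/
theorem eventually_extendBot_lt {K V : Set M} {f : M → EReal} {x : M} {a b : EReal}
    (hV : IsOpen V) (hf : x ∈ V → UpperSemicontinuousWithinAt f K x) (hxa : extendBot V f x < a)
    (hb : b < a) (hout : x ∉ V → ∀ᶠ y in 𝓝[K] x, y ∈ V → f y ≤ b) :
    ∀ᶠ y in 𝓝[K] x, extendBot V f y < a := by
  by_cases hx : x ∈ V
  · rw [extendBot_of_mem f hx] at hxa
    filter_upwards [hf hx a hxa, nhdsWithin_le_nhds (hV.mem_nhds hx)] with y h1 h2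
    rwa [extendBot_of_mem f h2]
  · filter_upwards [hout hx] with y h1
    exact (extendBot_le h1).trans_lt hb

end EReal

/-! ### Subharmonic functions -/

section Subharmonic

variable {n : ℕ} {M : Type*} [TopologicalSpace M] [ChartedSpace (Eu n) M]
  {G : Set (JetBundle n M)}

/-- The condition on test functions at one point. -/
def SatisfiesTestAt (G : Set (JetBundle n M)) (u : M → EReal) (x : M) : Prop :=
  ∀ ψ : M → ℝ, ContMDiffAt (𝓡 n) 𝓘(ℝ, ℝ) 2 ψ x →
    (∀ᶠ y in 𝓝 x, u y ≤ (ψ y : EReal)) → u x = (ψ x : EReal) → jetAt ψ x ∈ G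

/-- Every test function for the larger function at `x` is also one for the smaller function. This
local principle is behind all gluing by maxima. -/
theorem SatisfiesTestAt.of_le {u v : M → EReal} {x : M} (hu : SatisfiesTestAt G u x)
    (hle : ∀ᶠ y in 𝓝 x, u y ≤ v y) (heq : u x = v x) : SatisfiesTestAt G v x :=
  fun ψ hψ h1 h2 => hu ψ hψ ((hle.and h1).mono fun _ h => h.1.trans h.2) (heq.trans h2)

theorem IsSubharmonicOn.congr {W : Set M} {u v : M → EReal} (hW : IsOpen W)
    (hu : IsSubharmonicOn G W u) (h : EqOn u v W) : IsSubharmonicOn G W v where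
  usc := fun x hx a ha => by
    change v x < a at ha
    rw [← h hx] at ha
    filter_upwards [hu.usc x hx a ha, self_mem_nhdsWithin] with y h1 h2
    rwa [← h h2]
  lt_top x hx := by
    rw [← h hx]
    exact hu.lt_top x hx
  test x hx := SatisfiesTestAt.of_le (hu.test x hx)
    (by filter_upwards [hW.mem_nhds hx] with y hy using (h hy).le) (h hx)

/-- Where the value is `-∞` no real test function can touch, so the condition is vacuous outside
`V`. -/
theorem SatisfiesTestAt.extendBot {V : Set M} {f : M → EReal} {x : M} (hV : IsOpen V)
    (h : x ∈ V → SatisfiesTestAt G f x) : SatisfiesTestAt G (extendBot V f) x := by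
  by_cases hx : x ∈ V
  · refine (h hx).of_le ?_ (extendBot_of_mem f hx).symm
    filter_upwards [hV.mem_nhds hx] with y hy using (extendBot_of_mem f hy).ge
  · intro ψ _ _ h2
    rw [extendBot_of_notMem f hx] at h2
    exact absurd h2.symm (EReal.coe_ne_bot _)

theorem SatisfiesTestAt.sup {u v : M → EReal} {x : M} (hu : SatisfiesTestAt G u x)
    (hv : SatisfiesTestAt G v x) : SatisfiesTestAt G (fun y => u y ⊔ v y) x := by
  rcases le_total (u x) (v x) with h | h
  · exact hv.of_le (Eventually.of_forall fun _ => le_sup_right) (sup_eq_right.2 h).symm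
  · exact hu.of_le (Eventually.of_forall fun _ => le_sup_left) (sup_eq_left.2 h).symm

theorem SatisfiesTestAt.iSup {ι : Type*} [Finite ι] {u : ι → M → EReal} {x : M}
    (hu : ∀ i, SatisfiesTestAt G (u i) x) : SatisfiesTestAt G (fun y => ⨆ i, u i y) x := by
  rcases isEmpty_or_nonempty ι with _ | _
  · intro ψ _ _ h
    change (⨆ i, u i x) = _ at h
    rw [iSup_of_empty] at h
    exact absurd h.symm (EReal.coe_ne_bot _)
  · obtain ⟨i, hi⟩ := exists_eq_ciSup_of_finite (f := fun i => u i x)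
    exact (hu i).of_le (Eventually.of_forall fun y => le_iSup (fun i => u i y) i) hi

theorem IsMonotone.satisfiesTestAt [IsManifold (𝓡 n) ∞ M] (hG : IsMonotone G) {f : M → ℝ} {x : M}
    (hf : ContMDiffAt (𝓡 n) 𝓘(ℝ, ℝ) 2 f x) (hx : jetAt f x ∈ G) :
    SatisfiesTestAt G (fun y => (f y : EReal)) x := by
  intro ψ hψ h1 h2
  exact hG.jetAt_mem_of_touch hf hψ (h1.mono fun _ h => EReal.coe_le_coe_iff.1 h)
    (EReal.coe_eq_coe_iff.1 h2) hx

theorem jetAt_add_const {ψ : M → ℝ} {x : M} [IsManifold (𝓡 n) ∞ M]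
    (hψ : ContMDiffAt (𝓡 n) 𝓘(ℝ, ℝ) 2 ψ x) (c : ℝ) :
    jetAt (n := n) (fun y => ψ y + c) x = ⟨x, (jetAt (n := n) ψ x).jet + (c, 0, 0)⟩ := by
  have h := contDiffAt_comp_symm (IsManifold.chart_mem_maximalAtlas x)
    (mem_chart_source (Eu n) x) hψ
  rw [jetAt_eq, jetAt_eq, ← jetEu_const c (chartAt (Eu n) x x), ← jetEu_add h contDiffAt_const]
  rfl

theorem IsMonotone.isSubharmonicOn_add_const [IsManifold (𝓡 n) ∞ M] (hG : IsMonotone G)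
    {W : Set M} {u : M → EReal} (hu : IsSubharmonicOn G W u) {c : ℝ} (hc : c ≤ 0) :
    IsSubharmonicOn G W fun y => u y + (c : EReal) where
  usc := upperSemicontinuousOn_add_coe hu.usc continuousOn_const
  lt_top x hx := EReal.add_lt_top (hu.lt_top x hx).ne (EReal.coe_ne_top _)
  test x hx ψ hψ h1 h2 := by
    have hψ' : ContMDiffAt (𝓡 n) 𝓘(ℝ, ℝ) 2 (fun y => ψ y + -c) x :=
      hψ.add contMDiffAt_const
    have h3 := hu.test x hx (fun y => ψ y + -c) hψ'
      (h1.mono fun y h => add_coe_le_coe_iff.1 h) (add_coe_eq_coe_iff.1 h2)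
    have h4 := hG.negativity x _ c hc (show (jetAt (fun y => ψ y + -c) x).jet ∈ fibre G x from h3)
    have h5 := jetAt_add_const hψ' c
    simp only [neg_add_cancel_right] at h5
    rw [h5]
    exact h4

/-- Nested neighbourhoods of a point in its preferred chart. -/
theorem exists_nested_nhds [T2Space M] {x : M} {N : Set M} (hN : N ∈ 𝓝 x) :
    ∃ (S B V : Set M) (η : ℝ), IsOpen S ∧ IsCompact B ∧ IsOpen V ∧ 0 < η ∧ x ∈ S ∧ S ⊆ B ∧ B ⊆ V ∧
      V ⊆ N ∧ V ⊆ (chartAt (Eu n) x).source ∧ ∀ y ∈ V, y ∉ S → η ≤ sqDist n x y := by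
  set c := chartAt (Eu n) x with hc
  have hxc : x ∈ c.source := mem_chart_source (Eu n) x
  obtain ⟨R, hR, ht, hsub⟩ := exists_ball_of_mem_nhds hxc hN
  have hcb : Metric.closedBall (c x) (R / 2) ⊆ Metric.ball (c x) R :=
    Metric.closedBall_subset_ball (by linarith)
  refine ⟨c.symm '' Metric.ball (c x) (R / 2), c.symm '' Metric.closedBall (c x) (R / 2),
    c.symm '' Metric.ball (c x) R, (R / 2) ^ 2, ?_, ?_, ?_, by positivity, ?_, ?_, ?_, ?_, ?_, ?_⟩
  · exact c.symm.isOpen_image_of_subset_source Metric.isOpen_ball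
      ((Metric.ball_subset_closedBall.trans hcb).trans ht)
  · exact (isCompact_closedBall _ _).image_of_continuousOn
      (c.continuousOn_symm.mono (hcb.trans ht))
  · exact c.symm.isOpen_image_of_subset_source Metric.isOpen_ball ht
  · exact ⟨c x, Metric.mem_ball_self (by positivity), c.left_inv hxc⟩
  · exact image_mono Metric.ball_subset_closedBall
  · exact image_mono hcb
  · rintro _ ⟨z, hz, rfl⟩
    exact hsub z hz
  · rintro _ ⟨z, hz, rfl⟩
    exact c.map_target (ht hz)
  · rintro _ ⟨z, hz, rfl⟩ hS
    have hz' : z ∉ Metric.ball (c x) (R / 2) := fun h => hS (mem_image_of_mem _ h)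
    rw [Metric.mem_ball, not_lt, dist_eq_norm] at hz'
    unfold sqDist
    rw [← hc, c.right_inv (ht hz)]
    exact pow_le_pow_left₀ (by positivity) hz' 2

/-- The upper semicontinuous regularization of the upper envelope of a family of functions in
`F(U)` passes the test at the points of `U`, as `F` is closed. -/
theorem satisfiesTestAt_uscHull [T2Space M] [IsManifold (𝓡 n) ∞ M] {F : Set (JetBundle n M)}
    (hF : IsClosed F) {E : Set (M → EReal)} {U K : Set M} (hU : IsOpen U) (hUK : U ⊆ K)
    (hE : ∀ w ∈ E, IsSubharmonicOn F U w) {u : M → EReal} (hEu : ∀ w ∈ E, ∀ y ∈ U, w y ≤ u y)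
    (huE : ∀ y ∈ U, ∀ a < u y, ∃ w ∈ E, a < w y) {x : M} (hx : x ∈ U) :
    SatisfiesTestAt F (uscHull K u) x := by
  intro ψ hψ hle heq
  by_contra hjet
  have hev := eventually_jetAt_perturb_mem hF.isOpen_compl hψ hjet
  rw [nhds_prod_eq, nhds_prod_eq] at hev
  obtain ⟨pa, hpa, pb, hpb, hab⟩ := eventually_prod_iff.1 hev
  obtain ⟨pc, hpc, pd, hpd, hcd⟩ := eventually_prod_iff.1 hpb
  obtain ⟨κ₀, hκ₀, hκ⟩ := Metric.eventually_nhds_iff.1 hpc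
  obtain ⟨s₀, hs₀, hs⟩ := Metric.eventually_nhds_iff.1 hpd
  set κ : ℝ := κ₀ / 2 with hκdef
  have hκpos : 0 < κ := by positivity
  have hjets : ∀ y, pa y → ∀ s : ℝ, |s| < s₀ → jetAt (perturb n x ψ (-κ) s) y ∉ F := by
    intro y hy s hs'
    refine hab hy (hcd (hκ ?_) (hs ?_)) (y := (-κ, s))
    · rw [Real.dist_eq, sub_zero, abs_neg, abs_of_pos hκpos]
      linarith
    · rwa [Real.dist_eq, sub_zero]
  have hN : {y | pa y ∧ y ∈ U ∧ uscHull K u y ≤ (ψ y : EReal) ∧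
      ContMDiffAt (𝓡 n) 𝓘(ℝ, ℝ) 2 ψ y} ∈ 𝓝 x :=
    hpa.and (Filter.Eventually.and (hU.mem_nhds hx) (hle.and (contMDiffAt_eventually hψ)))
  obtain ⟨S, B, V, η, hS, hB, -, hη, hxS, hSB, hBV, hVN, hVc, hout⟩ :=
    exists_nested_nhds (n := n) hN
  have hψc : ∀ y ∈ V, ContMDiffAt (𝓡 n) 𝓘(ℝ, ℝ) 2 (perturb n x ψ (-κ) 0) y := fun y hy =>
    contMDiffAt_perturb (hVN hy).2.2.2 (hVc hy) _ _
  -- Adding `κ` times the squared distance makes the contact at `x` strict while the jets stay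
  -- outside `F`.
  set θ : M → ℝ := perturb n x ψ (-κ) 0 with hθdef
  have hθ : ∀ y, θ y = ψ y + κ * sqDist n x y := fun y => by simp [hθdef, perturb]
  -- The bound by `s₀ / 2` keeps the translate of `θ` used below within the admissible
  -- perturbations. The other bound forces the maximum into `S`, since `w - θ ≤ -κ * η < -τ` on `B`
  -- outside `S`.
  set τ : ℝ := min (s₀ / 2) (κ * η / 2) with hτ
  have hτpos : 0 < τ := by positivity
  have hxV : x ∈ V := hBV (hSB hxS)
  obtain ⟨y, hyS, hy⟩ : ∃ y ∈ S, ((θ y - τ : ℝ) : EReal) < u y := by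
    by_contra! hcon
    have h1 : uscHull K u x ≤ ((θ x - τ : ℝ) : EReal) := by
      refine uscHull_le_coe (θ := fun y => θ y - τ) ?_ ?_
      · exact ((hψc x hxV).continuousAt.sub continuousAt_const).continuousWithinAt
      · filter_upwards [nhdsWithin_le_nhds (hS.mem_nhds hxS)] with y hy using hcon y hy
    rw [heq, EReal.coe_le_coe_iff, hθ, sqDist_self] at h1
    linarith
  have hyU : ∀ y ∈ B, y ∈ U := fun y hy => (hVN (hBV hy)).2.1
  obtain ⟨w, hwE, hw⟩ := huE y (hyU y (hSB hyS)) _ hy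
  have hwψ : ∀ y ∈ B, w y ≤ (ψ y : EReal) := fun y hy =>
    (hEu w hwE y (hyU y hy)).trans
      ((le_uscHull (hUK (hyU y hy))).trans (hVN (hBV hy)).2.2.1)
  have husc : UpperSemicontinuousOn (fun y => w y + ((-θ y : ℝ) : EReal)) B := by
    refine upperSemicontinuousOn_add_coe (θ := fun y => -θ y) ?_ ?_
    · exact fun z hz a ha =>
        ((hE w hwE).usc z (hyU z hz) a ha).filter_mono (nhdsWithin_mono z hyU)
    · exact fun z hz => (hψc z (hBV hz)).continuousAt.neg.continuousWithinAt
  -- At this maximum of `w - θ` a translate of `θ` touches the single member `w` from above. Its jet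
  -- would then lie in `F`, against the choice of the perturbations.
  obtain ⟨z, hzB, hz⟩ := husc.exists_isMaxOn ⟨x, hSB hxS⟩ hB
  have hzV := hBV hzB
  -- the maximum is a real number close to zero
  have hwz : w z ≤ (ψ z : EReal) := hwψ z hzB
  have hge : w y + ((-θ y : ℝ) : EReal) ≤ w z + ((-θ z : ℝ) : EReal) := hz (hSB hyS)
  have hlow : ((-τ : ℝ) : EReal) < w z + ((-θ z : ℝ) : EReal) := by
    refine lt_of_lt_of_le ?_ hge
    by_contra! hcon
    rw [add_coe_le_coe_iff] at hcon
    refine absurd (hw.trans_le hcon) ?_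
    rw [EReal.coe_lt_coe_iff]
    linarith
  have hnb : w z ≠ ⊥ := by
    intro h
    rw [h, EReal.bot_add] at hlow
    exact absurd hlow not_lt_bot
  have hnt : w z ≠ ⊤ := (hwz.trans_lt (EReal.coe_lt_top _)).ne
  lift w z to ℝ using ⟨hnt, hnb⟩ with wz hwzr
  have hlow' : -τ < wz - θ z := by
    have : ((-τ : ℝ) : EReal) < ((wz + -θ z : ℝ) : EReal) := by
      rw [EReal.coe_add]
      exact hlow
    rw [EReal.coe_lt_coe_iff] at this
    linarith
  have hup : wz ≤ ψ z := EReal.coe_le_coe_iff.1 hwz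
  have hq := sqDist_nonneg (n := n) x z
  have hzS : z ∈ S := by
    by_contra hzS
    have h1 := hout z hzV hzS
    have h2 : κ * η ≤ κ * sqDist n x z := mul_le_mul_of_nonneg_left h1 hκpos.le
    have h3 : τ ≤ κ * η / 2 := min_le_right _ _
    have h4 : 0 < κ * η := by positivity
    rw [hθ] at hlow'
    linarith
  have hm : |wz - θ z| < s₀ := by
    have h3 : τ ≤ s₀ / 2 := min_le_left _ _
    have h4 := mul_nonneg hκpos.le hq
    rw [hθ] at hlow' ⊢
    rw [abs_lt]
    constructor <;> linarith
  have hpert : ∀ y, perturb n x ψ (-κ) (wz - θ z) y = θ y + (wz - θ z) := fun y => by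
    rw [hθ y, perturb]
    ring
  refine hjets z (hVN hzV).1 _ hm ((hE w hwE).test z (hyU z hzB) _
    (contMDiffAt_perturb (hVN hzV).2.2.2 (hVc hzV) _ _) ?_ ?_)
  · filter_upwards [hS.mem_nhds hzS] with y' hy'
    have h1 : w y' + ((-θ y' : ℝ) : EReal) ≤ (wz : EReal) + ((-θ z : ℝ) : EReal) := by
      rw [hwzr]
      exact hz (hSB hy')
    rw [← EReal.coe_add, add_coe_le_coe_iff] at h1
    rw [hpert]
    convert h1 using 2
    ring
  · rw [hpert, ← hwzr]
    congr 1
    ring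

end Subharmonic

/-! ### Barriers at strictly convex boundary points -/

section Barriers

variable {n : ℕ} {M : Type*} [TopologicalSpace M] [ChartedSpace (Eu n) M] {U : Set M}
  {G : Set (JetBundle n M)}

theorem upperSemicontinuousOn_bddAbove {u : M → EReal} {K : Set M} (hK : IsCompact K)
    (hu : UpperSemicontinuousOn u K) (hlt : ∀ x ∈ K, u x < ⊤) :
    ∃ C : ℝ, ∀ x ∈ K, u x ≤ (C : EReal) := by
  rcases K.eq_empty_or_nonempty with rfl | hne
  · exact ⟨0, by simp⟩
  obtain ⟨z, hz, hmax⟩ := hu.exists_isMaxOn hne hK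
  obtain ⟨C, hC, -⟩ := EReal.lt_iff_exists_real_btwn.1 (hlt z hz)
  exact ⟨C, fun x hx => (hmax hx).trans hC.le⟩

/-- The local bounds come from continuity of `φ` viewed on the image of `∂U`. Compactness of
`closure U \ U` combines them, without compactness of `∂U` itself. -/
theorem ClosureHasCorners.exists_lower_bound (hU : ClosureHasCorners n U) (hUo : IsOpen U)
    (hUc : IsCompact (closure U)) {φ : CornerBoundary n U → ℝ} (hφ : Continuous φ)
    (hφc : Consistent φ) : ∃ L : ℝ, ∀ b, L ≤ φ b := by
  have hcpt : IsCompact (closure U \ U) := hUc.diff hUo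
  obtain ⟨L, hL⟩ := hcpt.induction_on
    (p := fun S => ∃ L : ℝ, ∀ b : CornerBoundary n U, b.pt ∈ S → L ≤ φ b)
    ⟨0, by simp⟩
    (fun S T hST ⟨L, hL⟩ => ⟨L, fun b hb => hL b (hST hb)⟩)
    (fun S T ⟨L, hL⟩ ⟨L', hL'⟩ => ⟨min L L', fun b hb => hb.elim
      (fun h => (min_le_left _ _).trans (hL b h)) fun h => (min_le_right _ _).trans (hL' b h)⟩)
    (fun x hx => by
      obtain ⟨b, rfl⟩ := hU.exists_boundary_point hx.1 hx.2
      refine ⟨_, nhdsWithin_le_nhds (hU.eventually_abs_sub_lt hUo hφ hφc b one_pos), φ b - 1,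
        fun b' hb' => ?_⟩
      have := (abs_lt.1 (hb' b' rfl)).1
      linarith)
  exact ⟨L, fun b => hL b (b.pt_mem_diff hUo)⟩

variable [IsManifold (𝓡 n) ∞ M]

theorem jetAt_const_mul {ψ : M → ℝ} {x : M}
    (hψ : ContMDiffAt (𝓡 n) 𝓘(ℝ, ℝ) 2 ψ x) (c : ℝ) :
    jetAt (n := n) (fun y => c * ψ y) x = ⟨x, c • (jetAt (n := n) ψ x).jet⟩ := by
  have h := contDiffAt_comp_symm (IsManifold.chart_mem_maximalAtlas x)
    (mem_chart_source (Eu n) x) hψ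
  rw [jetAt_eq, jetAt_eq, ← jetEu_const_mul c h]
  rfl

variable [T2Space M]

/-- At a strictly `G`-convex boundary point there is a function `w ≤ 0` which vanishes at this
point only, and whose large multiples are `G`-subharmonic. -/
theorem IsMonotone.exists_barrier (hG : IsMonotone G) (hUo : IsOpen U) {b : CornerBoundary n U}
    (hb : StrictlyConvexAt G b) (r₀ : ℝ) {N : Set M} (hN : N ∈ 𝓝 b.pt) :
    ∃ (V B : Set M) (w : M → ℝ) (η t₀ : ℝ), IsOpen V ∧ IsClosed B ∧ 0 < η ∧ 0 < t₀ ∧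
      b.pt ∈ V ∧ B ⊆ V ∧ V ⊆ N ∧ ContinuousOn w V ∧ w b.pt = 0 ∧
      (∀ y ∈ V, y ∈ closure U → w y ≤ 0) ∧ (∀ y ∈ V, y ∈ closure U → y ∉ B → w y ≤ -η) ∧
      ∀ t : ℝ, t₀ ≤ t → ∀ r ≤ r₀, ∀ y ∈ V, y ∈ U →
        SatisfiesTestAt G (fun y => ((r + t * w y : ℝ) : EReal)) y := by
  obtain ⟨ρ, hρ, N₁, hN₁, t₀, ht₀, hN₁t⟩ := hb r₀
  obtain ⟨hρ2, hρ0, hρU⟩ := hρ.basic hUo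
  set x := b.pt with hx
  -- Neighbourhoods of reduced jets come from neighbourhoods of full jets with value `0`; the jet of
  -- `ρ` at `x` is of this kind.
  rw [nhds_induced, mem_comap] at hN₁
  obtain ⟨O', hO', hO'N⟩ := hN₁
  have hjx : jetAt ρ x ∈ interior O' := by
    have h1 := mem_interior_iff_mem_nhds.2 hO'
    have h2 : (jetAt (n := n) ρ x) = ⟨x, (0, (redJetAt (n := n) ρ x).jet)⟩ := by
      change (⟨x, (ρ x, _)⟩ : JetBundle n M) = ⟨x, (0, _)⟩
      rw [hρ0]
      rfl
    rw [h2]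
    exact h1
  have hev := eventually_jetAt_perturb_mem isOpen_interior hρ2 hjx
  rw [nhds_prod_eq, nhds_prod_eq] at hev
  obtain ⟨pa, hpa, pb, hpb, hab⟩ := eventually_prod_iff.1 hev
  obtain ⟨pc, hpc, pd, hpd, hcd⟩ := eventually_prod_iff.1 hpb
  obtain ⟨κ₀, hκ₀, hκ⟩ := Metric.eventually_nhds_iff.1 hpc
  obtain ⟨s₀, hs₀, hs⟩ := Metric.eventually_nhds_iff.1 hpd
  set κ : ℝ := κ₀ / 2 with hκdef
  have hκpos : 0 < κ := by positivity
  have hjets : ∀ y, pa y → ∀ s : ℝ, |s| < s₀ → jetAt (perturb n x ρ κ s) y ∈ O' := by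
    intro y hy s hs'
    refine interior_subset (hab hy (hcd (hκ ?_) (hs ?_)) (y := (κ, s)))
    · rw [Real.dist_eq, sub_zero, abs_of_pos hκpos]
      linarith
    · rwa [Real.dist_eq, sub_zero]
  -- The defining function vanishes along a whole sheet; subtracting `κ` times the squared distance
  -- leaves `x` as its only zero in `closure U` nearby.
  set w : M → ℝ := perturb n x ρ κ 0 with hw
  have hwy : ∀ y, w y = ρ y - κ * sqDist n x y := fun y => by
    rw [hw, perturb]
    ring
  have hwx : w x = 0 := by simp [hwy, hρ0, sqDist_self]
  have hw2 : ContMDiffAt (𝓡 n) 𝓘(ℝ, ℝ) 2 w x :=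
    contMDiffAt_perturb hρ2 (mem_chart_source (Eu n) x) _ _
  have hwsmall : ∀ᶠ y in 𝓝 x, |-w y| < s₀ := by
    have : ContinuousAt (fun y => |-w y|) x := hw2.continuousAt.neg.abs
    exact this.eventually_lt_const (by simpa [hwx] using hs₀)
  have hN' : {y | y ∈ N ∧ pa y ∧ (y ∈ U → ρ y < 0) ∧ ContMDiffAt (𝓡 n) 𝓘(ℝ, ℝ) 2 ρ y ∧
      |-w y| < s₀} ∈ 𝓝 x :=
    Filter.Eventually.and hN (hpa.and (hρU.and ((contMDiffAt_eventually hρ2).and hwsmall)))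
  obtain ⟨S, B, V, η, hS, hB, hV, hη, hxS, hSB, hBV, hVN, hVc, hout⟩ :=
    exists_nested_nhds (n := n) hN'
  have hwV : ∀ y ∈ V, ContMDiffAt (𝓡 n) 𝓘(ℝ, ℝ) 2 w y := fun y hy =>
    contMDiffAt_perturb (hVN hy).2.2.2.1 (hVc hy) _ _
  have hρle : ∀ y ∈ V, y ∈ closure U → ρ y ≤ 0 := by
    intro y hy hyU
    have : (𝓝[U] y).NeBot := mem_closure_iff_nhdsWithin_neBot.1 hyU
    refine le_of_tendsto ((hVN hy).2.2.2.1.continuousAt.continuousWithinAt (s := U)) ?_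
    filter_upwards [nhdsWithin_le_nhds (hV.mem_nhds hy), self_mem_nhdsWithin] with z hz hzU
    exact ((hVN hz).2.2.1 hzU).le
  have hwle : ∀ y ∈ V, y ∈ closure U → w y ≤ 0 := fun y hy hyU => by
    have h1 := hρle y hy hyU
    have h2 := mul_nonneg hκpos.le (sqDist_nonneg (n := n) x y)
    rw [hwy]
    linarith
  refine ⟨V, B, w, κ * η, t₀, hV, hB.isClosed, by positivity, ht₀, hBV (hSB hxS), hBV,
    fun y hy => (hVN hy).1, fun y hy => (hwV y hy).continuousAt.continuousWithinAt, hwx, hwle,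
    fun y hy hyU hyB => ?_, fun t ht r hr y hy hyU => ?_⟩
  · have h1 := hρle y hy hyU
    have h2 := mul_le_mul_of_nonneg_left (hout y hy fun h => hyB (hSB h)) hκpos.le
    rw [hwy]
    linarith
  · have hjw : (⟨y, (0, (jetAt (n := n) w y).jet.2)⟩ : JetBundle n M) ∈ O' := by
      -- Translating by `-w y` brings the value at `y` to `0`, as the topology of reduced jets
      -- demands, without changing the reduced jet.
      have h1 := hjets y (hVN hy).2.1 (-w y) (hVN hy).2.2.2.2
      have h2 : perturb n x ρ κ (-w y) = fun z => w z + -w y := by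
        funext z
        rw [hwy z, perturb]
        ring
      rw [h2, jetAt_add_const (hwV y hy)] at h1
      have h3 : (jetAt (n := n) w y).jet + (-w y, 0, 0) = (0, (jetAt (n := n) w y).jet.2) := by
        refine Prod.ext ?_ (Prod.ext ?_ ?_)
        · change w y + -w y = 0
          ring
        · exact add_zero _
        · exact add_zero _
      rwa [h3] at h1
    have hred : redJetAt w y ∈ N₁ := hO'N hjw
    have hmem := hN₁t t ht _ hred
    have htw : ContMDiffAt (𝓡 n) 𝓘(ℝ, ℝ) 2 (fun z => t * w z) y :=
      contMDiffAt_const.mul (hwV y hy)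
    have hrw : ContMDiffAt (𝓡 n) 𝓘(ℝ, ℝ) 2 (fun z => t * w z + r) y :=
      htw.add contMDiffAt_const
    -- Asymptotic convexity gives a jet with value `r₀`. The actual value `r + t * w y` is at most
    -- `r₀`, because `w ≤ 0`, so (N) covers the difference.
    have hneg := hG.negativity y _ (r + t * w y - r₀)
      (by nlinarith [hwle y hy (subset_closure hyU)]) hmem
    have hj : jetAt (fun z => t * w z + r) y ∈ G := by
      rw [jetAt_add_const htw, jetAt_const_mul (hwV y hy)]
      refine (congrArg (fun j => (⟨y, j⟩ : JetBundle n M) ∈ G) ?_).mp hneg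
      refine Prod.ext ?_ (Prod.ext ?_ ?_)
      · change r₀ + (r + t * w y - r₀) = t * w y + r
        ring
      · exact rfl
      · exact rfl
    rw [show (fun z => ((r + t * w z : ℝ) : EReal)) = fun z => ((t * w z + r : ℝ) : EReal) from
      funext fun z => by rw [add_comm]]
    exact hG.satisfiesTestAt hrw hj

theorem iSup_lt_of_finite {ι : Type*} [Finite ι] {f : ι → EReal} {a : EReal} (ha : ⊥ < a)
    (h : ∀ i, f i < a) : ⨆ i, f i < a := by
  rcases isEmpty_or_nonempty ι with _ | _
  · rwa [iSup_of_empty]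
  · obtain ⟨i, hi⟩ := exists_eq_ciSup_of_finite (f := f)
    rw [← hi]
    exact h i

/-- If the whole boundary is strictly convex, a `G`-subharmonic function which is bounded from below
can be changed near the boundary into a bounded one. -/
theorem IsMonotone.exists_bounded_of_strictlyConvexAt (hG : IsMonotone G) (hUo : IsOpen U)
    (hUc : IsCompact (closure U)) (hU : ClosureHasCorners n U)
    (hconv : ∀ b : CornerBoundary n U, StrictlyConvexAt G b) {ψ : M → EReal}
    (hψ : IsSubharmonicOn G U ψ) (hbdd : BoundedBelowOn U ψ) :
    ∃ (v : M → EReal) (m C : ℝ), UpperSemicontinuousOn v (closure U) ∧ IsSubharmonicOn G U v ∧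
      ∀ x ∈ closure U, (m : EReal) ≤ v x ∧ v x ≤ (C : EReal) := by
  have hlc : LocallyCompactSpace M := ChartedSpace.locallyCompactSpace (Eu n) M
  have hcpt : IsCompact (closure U \ U) := hUc.diff hUo
  have hex : ∀ x : ↥(closure U \ U), ∃ (V B : Set M) (w : M → ℝ) (η t₀ : ℝ), IsOpen V ∧
      IsClosed B ∧ 0 < η ∧ 0 < t₀ ∧
      (x : M) ∈ V ∧ B ⊆ V ∧ ContinuousOn w V ∧ w x = 0 ∧
      (∀ y ∈ V, y ∈ closure U → w y ≤ 0) ∧ (∀ y ∈ V, y ∈ closure U → y ∉ B → w y ≤ -η) ∧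
      ∀ t : ℝ, t₀ ≤ t → ∀ r ≤ (0 : ℝ), ∀ y ∈ V, y ∈ U →
        SatisfiesTestAt G (fun y => ((r + t * w y : ℝ) : EReal)) y := by
    rintro ⟨x, hx⟩
    obtain ⟨b, rfl⟩ := hU.exists_boundary_point hx.1 hx.2
    obtain ⟨V, B, w, η, t₀, h1, h2, h3, h4, h5, h6, -, h⟩ :=
      hG.exists_barrier hUo (hconv b) 0 univ_mem
    exact ⟨V, B, w, η, t₀, h1, h2, h3, h4, h5, h6, h⟩
  choose V B w η t₀ hV hB hη ht₀ hxV hBV hwc hwx hw0 hwη htest using hex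
  -- the parts of the barriers close to zero cover the boundary
  let V' : ↥(closure U \ U) → Set M := fun x => V x ∩ w x ⁻¹' Ioi (-(η x / 4))
  have hV'o : ∀ x, IsOpen (V' x) := fun x => (hwc x).isOpen_inter_preimage (hV x) isOpen_Ioi
  have hV'x : ∀ x, (x : M) ∈ V' x := fun x => ⟨hxV x, by
    have := hη x
    simp only [mem_preimage, hwx, mem_Ioi]
    linarith⟩
  obtain ⟨T, hT⟩ := hcpt.elim_nhds_subcover' (fun x hx => V' ⟨x, hx⟩)
    fun x hx => (hV'o _).mem_nhds (hV'x ⟨x, hx⟩)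
  set O : Set M := ⋃ x ∈ T, V' x with hO
  have hOo : IsOpen O := isOpen_biUnion fun x _ => hV'o x
  have hK₁ : IsCompact (closure U \ O) := hUc.diff hOo
  have hK₁U : closure U \ O ⊆ U := fun y hy => by
    by_contra hyU
    exact hy.2 (hT ⟨hy.1, hyU⟩)
  -- The function `ψ` may be unbounded above near the boundary, so it is used only on a relatively
  -- compact part of `U`. Elsewhere the barriers take over.
  obtain ⟨Ω, hΩo, hK₁Ω, hΩU, hΩc⟩ := exists_open_between_and_isCompact_closure hK₁ hUo hK₁U
  obtain ⟨C₁, hC₁⟩ := upperSemicontinuousOn_bddAbove hΩc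
    (fun x hx a ha => (hψ.usc x (hΩU hx) a ha).filter_mono (nhdsWithin_mono x hΩU))
    fun x hx => hψ.lt_top x (hΩU hx)
  obtain ⟨C₀, hC₀⟩ := hbdd
  set C : ℝ := max C₁ 0 with hCdef
  have hCle : ∀ x ∈ Ω, ψ x ≤ (C : EReal) := fun x hx =>
    (hC₁ x (subset_closure hx)).trans (EReal.coe_le_coe_iff.2 (le_max_left _ _))
  -- The scaled barrier `(t / η a) * w a` is at least `-t / 4` on `V' a` and at most `-t` on
  -- `closure U` in `V a` outside `B a`. The shifted `ψ + c` is at most `-t / 4` on `Ω`; the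
  -- condition with `4 / 3` makes it at least `-t` there, and the last one makes the factors `t / η
  -- a` large enough for the barriers.
  obtain ⟨t, htpos, htC, htT⟩ : ∃ t : ℝ, 0 < t ∧ 4 / 3 * (C - C₀) ≤ t ∧
      ∀ a ∈ T, t₀ a * η a ≤ t := by
    obtain ⟨s, hs⟩ := (T.image fun a => t₀ a * η a).bddAbove
    refine ⟨max (max 1 (4 / 3 * (C - C₀))) s, ?_, ?_, fun a ha => ?_⟩
    · exact lt_max_of_lt_left (lt_max_of_lt_left one_pos)
    · exact (le_max_right _ _).trans (le_max_left _ _)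
    · exact (hs (Finset.mem_coe.2 (Finset.mem_image_of_mem _ ha))).trans (le_max_right _ _)
  set c : ℝ := -(C + t / 4) with hc
  have hcneg : c ≤ 0 := by
    have : 0 ≤ C := le_max_right _ _
    linarith
  have hψc := hG.isSubharmonicOn_add_const hψ hcneg
  let f : T → M → EReal := fun a y => ((0 + t / η a * w a y : ℝ) : EReal)
  let g : M → EReal := fun y => ψ y + (c : EReal)
  let u : M → EReal := fun y => (⨆ a : T, extendBot (V a) (f a) y) ⊔ extendBot Ω g y
  have hcoef : ∀ a : T, 0 < t / η a := fun a => div_pos htpos (hη a)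
  have hgle : ∀ y ∈ Ω, g y ≤ ((-(t / 4) : ℝ) : EReal) := fun y hy => by
    refine add_coe_le_coe_iff.2 ((hCle y hy).trans (EReal.coe_le_coe_iff.2 ?_))
    rw [hc]
    linarith
  have huO : ∀ y ∈ O, ((-(t / 4) : ℝ) : EReal) ≤ u y := fun y hy => by
    simp only [hO, mem_iUnion] at hy
    obtain ⟨a, ha, hya, hyw⟩ := hy
    refine le_trans ?_ (le_sup_left.trans' (le_iSup (fun a : T => extendBot (V a) (f a) y) ⟨a, ha⟩))
    rw [extendBot_of_mem _ hya, EReal.coe_le_coe_iff, zero_add]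
    have h1 : -(η a / 4) ≤ w a y := le_of_lt hyw
    have h2 := mul_le_mul_of_nonneg_left h1 (hcoef ⟨a, ha⟩).le
    have h3 : t / η a * -(η a / 4) = -(t / 4) := by
      have := (hη a).ne'
      field_simp
    rw [h3] at h2
    exact h2
  have huΩ : ∀ y ∈ closure U, y ∉ Ω → ((-(t / 4) : ℝ) : EReal) ≤ u y := fun y hyU hy =>
    huO y (by_contra fun h => hy (hK₁Ω ⟨hyU, h⟩))
  have hulow : ∀ y ∈ closure U, ((-t : ℝ) : EReal) ≤ u y := fun y hyU => by
    by_cases hy : y ∈ Ω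
    · refine le_trans ?_ le_sup_right
      rw [extendBot_of_mem _ hy]
      have h1 : (C₀ : EReal) + (c : EReal) ≤ ψ y + (c : EReal) :=
        add_le_add_left (hC₀ y (hΩU (subset_closure hy))) _
      refine le_trans ?_ h1
      rw [← EReal.coe_add, EReal.coe_le_coe_iff, hc]
      linarith
    · refine le_trans (EReal.coe_le_coe_iff.2 ?_) (huΩ y hyU hy)
      linarith
  have huup : ∀ y ∈ closure U, u y ≤ ((0 : ℝ) : EReal) := fun y hyU => by
    refine sup_le (iSup_le fun a => extendBot_le fun hy => ?_) (extendBot_le fun hy => ?_)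
    · rw [EReal.coe_le_coe_iff, zero_add]
      exact mul_nonpos_of_nonneg_of_nonpos (hcoef a).le (hw0 a y hy hyU)
    · refine (hgle y hy).trans (EReal.coe_le_coe_iff.2 ?_)
      linarith
  have husc : UpperSemicontinuousOn u (closure U) := by
    intro x hx a ha
    change u x < a at ha
    have h1 : ∀ i : T, ∀ᶠ y in 𝓝[closure U] x, extendBot (V i) (f i) y < a := fun i => by
      refine eventually_extendBot_lt (b := u x) (hV i) (fun hxV => ?_) (lt_of_le_of_lt ?_ ha) ha
        fun hxV => ?_
      · have : ContinuousWithinAt (f i) (closure U) x := by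
          refine continuous_coe_real_ereal.continuousAt.comp_continuousWithinAt ?_
          exact (continuousAt_const.add (continuousAt_const.mul
            ((hwc i).continuousAt ((hV i).mem_nhds hxV)))).continuousWithinAt
        exact this.upperSemicontinuousWithinAt
      · exact le_sup_left.trans' (le_iSup (fun a : T => extendBot (V a) (f a) x) i)
      -- Upon leaving `V i` the barrier is at most `-t`, which is a lower bound for `u` everywhere
      -- on `closure U`.
      · have hxB : x ∉ B i := fun h => hxV (hBV i h)
        filter_upwards [nhdsWithin_le_nhds ((hB i).isOpen_compl.mem_nhds hxB),
          self_mem_nhdsWithin] with y hyB hyU hyV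
        refine le_trans (EReal.coe_le_coe_iff.2 ?_) (hulow x hx)
        have h2 := mul_le_mul_of_nonneg_left (hwη i y hyV hyU hyB) (hcoef i).le
        have h3 : t / η i * -η i = -t := by
          have := (hη i).ne'
          field_simp
        rw [zero_add]
        linarith
    have h2 : ∀ᶠ y in 𝓝[closure U] x, extendBot Ω g y < a := by
      refine eventually_extendBot_lt (b := u x) hΩo (fun hxΩ => ?_)
        (lt_of_le_of_lt le_sup_right ha) ha fun hxΩ => ?_
      · have hxU := hΩU (subset_closure hxΩ)
        intro a' ha'
        have := hψc.usc x hxU a' ha'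
        rw [hUo.nhdsWithin_eq hxU] at this
        exact nhdsWithin_le_nhds this
      -- Upon leaving `Ω` the shifted `ψ` is at most `-t / 4`, and there some barrier already
      -- reaches this height.
      · exact Eventually.of_forall fun y hy => (hgle y hy).trans (huΩ x hx hxΩ)
    filter_upwards [eventually_all.2 h1, h2] with y h3 h4
    exact max_lt (iSup_lt_of_finite (bot_le.trans_lt ha) h3) h4
  refine ⟨u, -t, 0, husc, ⟨fun x hx a ha =>
    (husc x (subset_closure hx) a ha).filter_mono (nhdsWithin_mono x subset_closure),
    fun x hx => (huup x (subset_closure hx)).trans_lt (EReal.coe_lt_top _), fun x hx => ?_⟩,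
    fun x hx => ⟨hulow x hx, huup x hx⟩⟩
  refine SatisfiesTestAt.sup (SatisfiesTestAt.iSup fun a => ?_) ?_
  · refine SatisfiesTestAt.extendBot (hV a) fun hxa => htest a _ ?_ 0 le_rfl x hxa hx
    rw [le_div_iff₀ (hη a)]
    exact htT a a.2
  · exact SatisfiesTestAt.extendBot hΩo fun _ => hψc.test x hx

/-- A continuous subsolution on the compact set `closure U` is bounded, so one point of `A`
suffices. Without such a point the whole boundary is strictly convex, and the gluing construction
applies. -/
theorem IsMonotone.exists_bounded (hG : IsMonotone G) (hUo : IsOpen U)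
    (hUc : IsCompact (closure U)) (hU : ClosureHasCorners n U) {φ : CornerBoundary n U → ℝ}
    (hconv : StrictlyConvexFor G U φ)
    (hbdd : ∃ ψ : M → EReal, IsSubharmonicOn G U ψ ∧ BoundedBelowOn U ψ) :
    ∃ (v : M → EReal) (m C : ℝ), UpperSemicontinuousOn v (closure U) ∧ IsSubharmonicOn G U v ∧
      ∀ x ∈ closure U, (m : EReal) ≤ v x ∧ v x ≤ (C : EReal) := by
  obtain ⟨A, B, -, -, hAB, -, hA, hB⟩ := hconv
  rcases A.eq_empty_or_nonempty with rfl | ⟨p, hp⟩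
  · obtain ⟨ψ, hψ, hψb⟩ := hbdd
    rw [empty_union] at hAB
    exact hG.exists_bounded_of_strictlyConvexAt hUo hUc hU
      (fun b => hB b (by rw [hAB]; exact mem_univ b)) hψ hψb
  · obtain ⟨u, hu, hsub, -⟩ := hA p hp 1 one_pos
    obtain ⟨C, hC⟩ := hUc.exists_bound_of_continuousOn hu
    refine ⟨_, -C, C, hsub.usc, hsub.sub, fun x hx => ?_⟩
    have := abs_le.1 (hC x hx)
    exact ⟨EReal.coe_le_coe_iff.2 this.1, EReal.coe_le_coe_iff.2 this.2⟩

/-- Subsolutions which are close to the boundary values near a given boundary point, and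
bounded from below. -/
theorem IsMonotone.exists_subsolution_near (hG : IsMonotone G) (hUo : IsOpen U)
    (hUc : IsCompact (closure U)) (hU : ClosureHasCorners n U) {φ : CornerBoundary n U → ℝ}
    (hφ : Continuous φ) (hφc : Consistent φ) (hconv : StrictlyConvexFor G U φ)
    (hbdd : ∃ ψ : M → EReal, IsSubharmonicOn G U ψ ∧ BoundedBelowOn U ψ)
    (b : CornerBoundary n U) {δ : ℝ} (hδ : 0 < δ) :
    ∃ v : M → EReal, IsSubsolution G U φ v ∧
      ∀ᶠ y in 𝓝[closure U] b.pt, ((φ b - δ : ℝ) : EReal) ≤ v y := by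
  obtain ⟨v₀, m, C, hv₀usc, hv₀, hv₀b⟩ := hG.exists_bounded hUo hUc hU hconv hbdd
  obtain ⟨L, hL⟩ := hU.exists_lower_bound hUo hUc hφ hφc
  obtain ⟨A, B', -, -, hAB, -, hA, hB'⟩ := hconv
  rcases (hAB ▸ mem_univ b : b ∈ A ∪ B') with hb | hb
  · obtain ⟨u, hu, hsub, hub⟩ := hA b hb (δ / 2) (by positivity)
    refine ⟨_, hsub, ?_⟩
    have h1 := hu b.pt (b.pt_mem_diff hUo).1
    filter_upwards [h1.eventually (lt_mem_nhds (show φ b - δ < u b.pt by linarith))] with y hy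
    exact EReal.coe_le_coe_iff.2 hy.le
  · set r₀ : ℝ := φ b - δ / 2 with hr₀
    obtain ⟨V, B, w, η, t₀, hV, hB, hη, ht₀, hbV, hBV, hVN, hwc, hwb, hw0, hwη, htest⟩ :=
      hG.exists_barrier hUo (hB' b hb) r₀
        (hU.eventually_abs_sub_lt hUo hφ hφc b (half_pos hδ))
    -- The shift puts `v₀` below every boundary value, and is nonpositive so that (N) applies.
    set c : ℝ := min 0 (L - C) with hc
    have hc0 : c ≤ 0 := min_le_left _ _
    have hcL : c ≤ L - C := min_le_right _ _
    -- Large enough for the barrier to be subharmonic, and for `r₀ + t * w` to lie below `v₀ + c`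
    -- outside `B`, where `w ≤ -η`.
    set t : ℝ := max t₀ ((r₀ - m - c) / η) with ht
    have htη : r₀ - t * η ≤ m + c := by
      have h1 : (r₀ - m - c) / η ≤ t := le_max_right _ _
      rw [div_le_iff₀ hη] at h1
      linarith
    have htpos : 0 < t := lt_max_of_lt_left ht₀
    have hv₀c := hG.isSubharmonicOn_add_const hv₀ hc0
    let f : M → EReal := fun y => ((r₀ + t * w y : ℝ) : EReal)
    let g : M → EReal := fun y => v₀ y + (c : EReal)
    have hg : ∀ y ∈ closure U, ((m + c : ℝ) : EReal) ≤ g y := fun y hy => by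
      rw [EReal.coe_add]
      exact add_le_add_left (hv₀b y hy).1 _
    have hgL : ∀ y ∈ closure U, g y ≤ (L : EReal) := fun y hy =>
      add_coe_le_coe_iff.2 ((hv₀b y hy).2.trans (EReal.coe_le_coe_iff.2 (by linarith)))
    have hfr : ∀ y ∈ V, y ∈ closure U → f y ≤ (r₀ : EReal) := fun y hy hyU => by
      refine EReal.coe_le_coe_iff.2 ?_
      have := mul_nonpos_of_nonneg_of_nonpos htpos.le (hw0 y hy hyU)
      linarith
    have hgusc : UpperSemicontinuousOn g (closure U) :=
      upperSemicontinuousOn_add_coe hv₀usc continuousOn_const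
    have hfc : ∀ x ∈ V, ContinuousAt (fun y => r₀ + t * w y) x := fun x hx =>
      continuousAt_const.add (continuousAt_const.mul (hwc.continuousAt (hV.mem_nhds hx)))
    have husc : UpperSemicontinuousOn (fun y => extendBot V f y ⊔ g y) (closure U) := by
      intro x hx a ha
      change extendBot V f x ⊔ g x < a at ha
      have h1 : ∀ᶠ y in 𝓝[closure U] x, extendBot V f y < a := by
        refine eventually_extendBot_lt (b := g x) hV (fun hxV => ?_)
          (le_sup_left.trans_lt ha) (le_sup_right.trans_lt ha) fun hxV => ?_
        · have : ContinuousWithinAt f (closure U) x :=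
            continuous_coe_real_ereal.continuousAt.comp_continuousWithinAt
              (hfc x hxV).continuousWithinAt
          exact this.upperSemicontinuousWithinAt
        · have hxB : x ∉ B := fun h => hxV (hBV h)
          filter_upwards [nhdsWithin_le_nhds (hB.isOpen_compl.mem_nhds hxB),
            self_mem_nhdsWithin] with y hyB hyU hyV
          refine le_trans (EReal.coe_le_coe_iff.2 ?_) (hg x hx)
          have h2 := mul_le_mul_of_nonneg_left (hwη y hyV hyU hyB) htpos.le
          linarith
      filter_upwards [h1, hgusc x hx a (le_sup_right.trans_lt ha)] with y h3 h4
      exact max_lt h3 h4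
    have hlt : ∀ x ∈ closure U, extendBot V f x ⊔ g x < ⊤ := fun x hx =>
      max_lt ((extendBot_le fun hxV => hfr x hxV hx).trans_lt (EReal.coe_lt_top _))
        ((hgL x hx).trans_lt (EReal.coe_lt_top _))
    refine ⟨fun y => extendBot V f y ⊔ g y, ⟨husc, hlt, ⟨fun x hx a ha =>
      (husc x (subset_closure hx) a ha).filter_mono (nhdsWithin_mono x subset_closure),
      fun x hx => hlt x (subset_closure hx), fun x hx => ?_⟩, fun b' => ?_⟩, ?_⟩
    · exact SatisfiesTestAt.sup
        (SatisfiesTestAt.extendBot hV fun hxV => htest t (le_max_left _ _) r₀ le_rfl x hxV hx)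
        (hv₀c.test x hx)
    · have hb' := (b'.pt_mem_diff hUo).1
      refine sup_le (extendBot_le fun hV' => (hfr _ hV' hb').trans ?_)
        ((hgL _ hb').trans (EReal.coe_le_coe_iff.2 (hL b')))
      have := (abs_lt.1 (hVN hV' b' rfl)).1
      exact EReal.coe_le_coe_iff.2 (by linarith)
    · have h1 : ∀ᶠ y in 𝓝 b.pt, φ b - δ < r₀ + t * w y := by
        refine (hfc b.pt hbV).eventually (lt_mem_nhds ?_)
        change φ b - δ < r₀ + t * w b.pt
        rw [hwb, hr₀]
        linarith
      filter_upwards [nhdsWithin_le_nhds h1, nhdsWithin_le_nhds (hV.mem_nhds hbV)] with y h2 h3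
      refine le_trans ?_ le_sup_left
      rw [extendBot_of_mem _ h3]
      exact EReal.coe_le_coe_iff.2 h2.le

/-- There are subsolutions which are bounded from below. -/
theorem IsMonotone.exists_subsolution_bounded (hG : IsMonotone G) (hUo : IsOpen U)
    (hUc : IsCompact (closure U)) (hU : ClosureHasCorners n U) {φ : CornerBoundary n U → ℝ}
    (hφ : Continuous φ) (hφc : Consistent φ) (hconv : StrictlyConvexFor G U φ)
    (hbdd : ∃ ψ : M → EReal, IsSubharmonicOn G U ψ ∧ BoundedBelowOn U ψ) :
    ∃ (v : M → EReal) (m : ℝ), IsSubsolution G U φ v ∧ ∀ x ∈ closure U, (m : EReal) ≤ v x := by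
  obtain ⟨v₀, m, C, hv₀usc, hv₀, hv₀b⟩ := hG.exists_bounded hUo hUc hU hconv hbdd
  obtain ⟨L, hL⟩ := hU.exists_lower_bound hUo hUc hφ hφc
  set c : ℝ := min 0 (L - C) with hc
  have hcL : c ≤ L - C := min_le_right _ _
  have hle : ∀ y ∈ closure U, v₀ y + (c : EReal) ≤ (L : EReal) := fun y hy =>
    add_coe_le_coe_iff.2 ((hv₀b y hy).2.trans (EReal.coe_le_coe_iff.2 (by linarith)))
  refine ⟨fun y => v₀ y + (c : EReal), m + c,
    ⟨upperSemicontinuousOn_add_coe hv₀usc continuousOn_const,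
      fun x hx => (hle x hx).trans_lt (EReal.coe_lt_top _),
      hG.isSubharmonicOn_add_const hv₀ (min_le_left _ _), fun b =>
      (hle _ (b.pt_mem_diff hUo).1).trans (EReal.coe_le_coe_iff.2 (hL b))⟩, fun x hx => ?_⟩
  rw [EReal.coe_add]
  exact add_le_add_left (hv₀b x hx).1 _

end Barriers

/-! ### The Perron function -/

section Perron

variable {n : ℕ} {M : Type*} [TopologicalSpace M] [ChartedSpace (Eu n) M] {U : Set M}
  {F : Set (JetBundle n M)} {φ : CornerBoundary n U → ℝ}

theorem IsSubsolution.le_perron {w : M → EReal} (hw : IsSubsolution F U φ w) (y : M) :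
    w y ≤ perron F U φ y :=
  le_sSup ⟨w, hw, rfl⟩

theorem exists_lt_of_lt_perron {y : M} {a : EReal} (ha : a < perron F U φ y) :
    ∃ w ∈ {w | IsSubsolution F U φ w}, a < w y := by
  obtain ⟨_, ⟨w, hw, rfl⟩, h⟩ := lt_sSup_iff.1 ha
  exact ⟨w, hw, h⟩

theorem ComparisonHolds.add_le_zero (hcomp : ComparisonHolds F) (hUo : IsOpen U)
    (hUc : IsCompact (closure U)) (hU : ClosureHasCorners n U) {u v : M → EReal}
    (hu : IsSubsolution F U φ u) (hv : IsSubsolution (dual F) U (fun b => -φ b) v) :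
    ∀ x ∈ closure U, u x + v x ≤ 0 := by
  have hint := hU.interior_closure hUo
  refine hcomp _ hUc u v ⟨hu.usc, hu.lt_top, by rw [hint]; exact hu.sub⟩
    ⟨hv.usc, hv.lt_top, by rw [hint]; exact hv.sub⟩ fun x hx => ?_
  rw [hU.frontier_closure hUo] at hx
  obtain ⟨b, rfl⟩ := hU.exists_boundary_point hx.1 hx.2
  refine (add_le_add (hu.le_boundary b) (hv.le_boundary b)).trans ?_
  rw [← EReal.coe_add, add_neg_cancel, EReal.coe_zero]

/-- Comparison in the form used for the Perron family: one dual subsolution bounds all subsolutions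
from above at once. -/
theorem ComparisonHolds.le_neg (hcomp : ComparisonHolds F) (hUo : IsOpen U)
    (hUc : IsCompact (closure U)) (hU : ClosureHasCorners n U) {u v : M → EReal}
    (hu : IsSubsolution F U φ u) (hv : IsSubsolution (dual F) U (fun b => -φ b) v) {x : M}
    (hx : x ∈ closure U) {r : ℝ} (hr : (r : EReal) ≤ v x) : u x ≤ ((-r : ℝ) : EReal) := by
  have h := hcomp.add_le_zero hUo hUc hU hu hv x hx
  have h1 : u x + (r : EReal) ≤ ((0 : ℝ) : EReal) := (add_le_add_right hr _).trans h
  have h2 := add_coe_le_coe_iff.1 h1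
  rwa [zero_sub] at h2

theorem SolvesDirichlet.isSubsolution {g : M → ℝ} (hg : SolvesDirichlet F U φ g) :
    IsSubsolution F U φ fun x => (g x : EReal) :=
  ⟨(continuous_coe_real_ereal.comp_continuousOn hg.continuousOn).upperSemicontinuousOn,
    fun _ _ => EReal.coe_lt_top _, hg.sub, fun b => by rw [hg.boundary b]⟩

theorem SolvesDirichlet.isSubsolution_neg {g : M → ℝ} (hg : SolvesDirichlet F U φ g) :
    IsSubsolution (dual F) U (fun b => -φ b) fun x => ((-g x : ℝ) : EReal) :=
  ⟨(continuous_coe_real_ereal.comp_continuousOn hg.continuousOn.neg).upperSemicontinuousOn,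
    fun _ _ => EReal.coe_lt_top _, hg.neg_sub, fun b => by rw [hg.boundary b]⟩

theorem SolvesDirichlet.le (hcomp : ComparisonHolds F) (hUo : IsOpen U)
    (hUc : IsCompact (closure U)) (hU : ClosureHasCorners n U) {g h : M → ℝ}
    (hg : SolvesDirichlet F U φ g) (hh : SolvesDirichlet F U φ h) {x : M} (hx : x ∈ closure U) :
    g x ≤ h x := by
  have := hcomp.le_neg hUo hUc hU hg.isSubsolution hh.isSubsolution_neg hx le_rfl
  rwa [neg_neg, EReal.coe_le_coe_iff] at this

/-! ### Maximality and existence. -/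

variable [IsManifold (𝓡 n) ∞ M] [T2Space M]

/-- The lower regularization of the largest subsolution is a supersolution. -/
theorem satisfiesTestAt_dual_of_maximal (hF : IsMonotone F) (hUo : IsOpen U) {H : M → EReal}
    (hH : IsSubsolution F U φ H)
    (hmax : ∀ w, IsSubsolution F U φ w → ∀ y ∈ closure U, w y ≤ H y) {x : M} (hx : x ∈ U) :
    SatisfiesTestAt (dual F) (uscHull (closure U) fun y => -H y) x := by
  intro χ hχ hle heq
  by_contra hjet
  set χ' : M → ℝ := fun y => (-1) * χ y with hχ'
  have hχ'2 : ∀ y, ContMDiffAt (𝓡 n) 𝓘(ℝ, ℝ) 2 χ y → ContMDiffAt (𝓡 n) 𝓘(ℝ, ℝ) 2 χ' y :=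
    fun y hy => contMDiffAt_const.mul hy
  have hint : jetAt χ' x ∈ interior F := by
    have h1 : (⟨x, -(jetAt (n := n) χ x).jet⟩ : JetBundle n M) ∈ interior F :=
      not_not.1 hjet
    rw [hχ', jetAt_const_mul hχ]
    have h2 : (-1 : ℝ) • (jetAt (n := n) χ x).jet = -(jetAt (n := n) χ x).jet := by
      refine Prod.ext ?_ (Prod.ext ?_ ?_)
      · change (-1 : ℝ) * _ = -_
        ring
      · ext v
        change (-1 : ℝ) * _ = -_
        ring
      · refine symForm_ext fun v w => ?_
        change (-1 : ℝ) * _ = -_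
        ring
    rwa [h2]
  have hev := eventually_jetAt_perturb_mem isOpen_interior (hχ'2 x hχ) hint
  rw [nhds_prod_eq, nhds_prod_eq] at hev
  obtain ⟨pa, hpa, pb, hpb, hab⟩ := eventually_prod_iff.1 hev
  obtain ⟨pc, hpc, pd, hpd, hcd⟩ := eventually_prod_iff.1 hpb
  obtain ⟨κ₀, hκ₀, hκ⟩ := Metric.eventually_nhds_iff.1 hpc
  obtain ⟨s₀, hs₀, hs⟩ := Metric.eventually_nhds_iff.1 hpd
  set κ : ℝ := κ₀ / 2 with hκdef
  have hκpos : 0 < κ := by positivity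
  have hN : {y | pa y ∧ y ∈ U ∧ uscHull (closure U) (fun y => -H y) y ≤ (χ y : EReal) ∧
      ContMDiffAt (𝓡 n) 𝓘(ℝ, ℝ) 2 χ y} ∈ 𝓝 x :=
    hpa.and (Filter.Eventually.and (hUo.mem_nhds hx) (hle.and (contMDiffAt_eventually hχ)))
  obtain ⟨S, B, V, η, hS, hB, hV, hη, hxS, hSB, hBV, hVN, hVc, hout⟩ :=
    exists_nested_nhds (n := n) hN
  -- The raise by `τ` is compensated outside `S` by the drop `κ * η`, so `f ≤ -χ ≤ H` there and the
  -- maximum of `f` and `H` glues. At `x` the raise survives.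
  set τ : ℝ := min (s₀ / 2) (κ * η) with hτ
  have hτpos : 0 < τ := by positivity
  set f : M → ℝ := perturb n x χ' κ τ with hf
  have hfy : ∀ y, f y = -χ y - κ * sqDist n x y + τ := fun y => by
    rw [hf, perturb, hχ']
    ring
  have hfV : ∀ y ∈ V, ContMDiffAt (𝓡 n) 𝓘(ℝ, ℝ) 2 f y := fun y hy =>
    contMDiffAt_perturb (hχ'2 y (hVN hy).2.2.2) (hVc hy) _ _
  have hfjet : ∀ y ∈ V, jetAt f y ∈ F := fun y hy => by
    refine interior_subset (hab (hVN hy).1 (hcd (hκ ?_) (hs ?_)) (y := (κ, τ)))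
    · rw [Real.dist_eq, sub_zero, abs_of_pos hκpos]
      linarith
    · rw [Real.dist_eq, sub_zero, abs_of_pos hτpos]
      exact (min_le_left _ _).trans_lt (by linarith)
  have hfH : ∀ y ∈ V, y ∉ B → (f y : EReal) ≤ H y := fun y hy hyB => by
    have h1 : -H y ≤ (χ y : EReal) :=
      (le_uscHull (f := fun y => -H y) (subset_closure (hVN hy).2.1)).trans (hVN hy).2.2.1
    have h2 := mul_le_mul_of_nonneg_left (hout y hy fun h => hyB (hSB h)) hκpos.le
    have h3 : τ ≤ κ * η := min_le_right _ _
    refine le_trans (EReal.coe_le_coe_iff.2 (?_ : f y ≤ -χ y)) ?_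
    · rw [hfy]
      linarith
    · rw [EReal.coe_neg]
      exact EReal.neg_le.1 h1
  have husc : UpperSemicontinuousOn (fun y => extendBot V (fun y => (f y : EReal)) y ⊔ H y)
      (closure U) := by
    intro z hz a ha
    change extendBot V (fun y => (f y : EReal)) z ⊔ H z < a at ha
    obtain ⟨c, hc, hca⟩ := exists_between (le_sup_right.trans_lt ha)
    have h1 : ∀ᶠ y in 𝓝[closure U] z, extendBot V (fun y => (f y : EReal)) y < a := by
      refine eventually_extendBot_lt (b := c) hV (fun hzV => ?_)
        (le_sup_left.trans_lt ha) hca fun hzV => ?_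
      · have : ContinuousWithinAt (fun y => (f y : EReal)) (closure U) z :=
          continuous_coe_real_ereal.continuousAt.comp_continuousWithinAt
            (hfV z hzV).continuousAt.continuousWithinAt
        exact this.upperSemicontinuousWithinAt
      · have hzB : z ∉ B := fun h => hzV (hBV h)
        filter_upwards [nhdsWithin_le_nhds (hB.isClosed.isOpen_compl.mem_nhds hzB),
          hH.usc z hz c hc] with y hyB hyc hyV
        exact (hfH y hyV hyB).trans hyc.le
    filter_upwards [h1, hH.usc z hz a (le_sup_right.trans_lt ha)] with y h3 h4
    exact max_lt h3 h4
  have hlt : ∀ z ∈ closure U, extendBot V (fun y => (f y : EReal)) z ⊔ H z < ⊤ := fun z hz =>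
    max_lt ((extendBot_le fun _ => le_rfl).trans_lt (EReal.coe_lt_top (f z))) (hH.lt_top z hz)
  have hsub : IsSubsolution F U φ fun y => extendBot V (fun y => (f y : EReal)) y ⊔ H y := by
    refine ⟨husc, hlt, ⟨fun z hz a ha =>
      (husc z (subset_closure hz) a ha).filter_mono (nhdsWithin_mono z subset_closure),
      fun z hz => hlt z (subset_closure hz), fun z hz => ?_⟩, fun b => ?_⟩
    · exact SatisfiesTestAt.sup
        (SatisfiesTestAt.extendBot hV fun hzV => hF.satisfiesTestAt (hfV z hzV) (hfjet z hzV))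
        (hH.sub.test z hz)
    · refine sup_le (extendBot_le fun hbV => ?_) (hH.le_boundary b)
      exact absurd (hVN hbV).2.1 (b.pt_mem_diff hUo).2
  have hxV : x ∈ V := hBV (hSB hxS)
  -- Maximality forces `f ≤ H` near `x`. This bounds the regularization at `x` by `χ x - τ`,
  -- although it equals `χ x`.
  have hN' : uscHull (closure U) (fun y => -H y) x ≤ ((-f x : ℝ) : EReal) := by
    refine uscHull_le_coe (θ := fun y => -f y) (hfV x hxV).continuousAt.neg.continuousWithinAt ?_
    filter_upwards [nhdsWithin_le_nhds (hV.mem_nhds hxV)] with y hy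
    have h1 := le_sup_left.trans (hmax _ hsub y (subset_closure (hVN hy).2.1))
    rw [extendBot_of_mem _ hy] at h1
    rw [EReal.coe_neg]
    exact EReal.neg_le_neg_iff.2 h1
  rw [heq, EReal.coe_le_coe_iff, hfy, sqDist_self] at hN'
  linarith

/-- The Dirichlet problem has a solution, namely the Perron function. -/
theorem exists_solvesDirichlet (hF : IsSubequation F) (hcomp : ComparisonHolds F)
    (hUo : IsOpen U) (hUc : IsCompact (closure U)) (hU : ClosureHasCorners n U)
    (hbdd : ∃ ψ : M → EReal, IsSubharmonicOn F U ψ ∧ BoundedBelowOn U ψ)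
    (hbdd_dual : ∃ ψ : M → EReal, IsSubharmonicOn (dual F) U ψ ∧ BoundedBelowOn U ψ)
    (hφ : Continuous φ) (hφc : Consistent φ) (hconv : StrictlyConvexFor F U φ)
    (hconv_dual : StrictlyConvexFor (dual F) U (fun b => -φ b)) :
    ∃ g : M → ℝ, SolvesDirichlet F U φ g ∧ ∀ x ∈ closure U, perron F U φ x = (g x : EReal) := by
  have hFm := hF.isMonotone
  have hDm := hFm.dual
  have hFcl : IsClosed F := by
    rw [hF.closure_interior]
    exact isClosed_closure
  have hφc' : Consistent fun b => -φ b := fun b b' h => congrArg Neg.neg (hφc b b' h)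
  obtain ⟨u₀, m, hu₀, hu₀m⟩ := hFm.exists_subsolution_bounded hUo hUc hU hφ hφc hconv hbdd
  obtain ⟨v₀, m', hv₀, hv₀m⟩ :=
    hDm.exists_subsolution_bounded hUo hUc hU hφ.neg hφc' hconv_dual hbdd_dual
  set K : Set M := closure U with hK
  set P : M → EReal := perron F U φ with hP
  set H : M → EReal := uscHull K P with hHdef
  have hPup : ∀ y ∈ K, P y ≤ ((-m' : ℝ) : EReal) := fun y hy => by
    refine sSup_le ?_
    rintro _ ⟨w, hw, rfl⟩
    exact hcomp.le_neg hUo hUc hU hw hv₀ hy (hv₀m y hy)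
  have hHup : ∀ y ∈ K, H y ≤ ((-m' : ℝ) : EReal) := fun y _ =>
    uscHull_le (by filter_upwards [self_mem_nhdsWithin] with z hz using hPup z hz)
  have hHbd : ∀ b : CornerBoundary n U, H b.pt ≤ (φ b : EReal) := fun b => by
    refine le_of_forall_gt_imp_ge_of_dense fun a ha => ?_
    obtain ⟨r, hr, hra⟩ := EReal.lt_iff_exists_real_btwn.1 ha
    have hr' := EReal.coe_lt_coe_iff.1 hr
    -- With `δ = r - φ b`, the lower bound `-φ b - δ` for `v` near `b` becomes the upper bound `r`
    -- for every subsolution.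
    obtain ⟨v, hv, hvn⟩ := hDm.exists_subsolution_near hUo hUc hU hφ.neg hφc' hconv_dual hbdd_dual
      b (δ := r - φ b) (by linarith)
    refine (uscHull_le ?_).trans hra.le
    filter_upwards [hvn, self_mem_nhdsWithin] with y hy hyK
    refine sSup_le ?_
    rintro _ ⟨w, hw, rfl⟩
    have := hcomp.le_neg hUo hUc hU hw hv hyK hy
    rwa [show -((-φ) b - (r - φ b)) = r by rw [Pi.neg_apply]; ring] at this
  have hHsub : IsSubsolution F U φ H := by
    refine ⟨upperSemicontinuousOn_uscHull K P,
      fun x hx => (hHup x hx).trans_lt (EReal.coe_lt_top _), ⟨fun x hx a ha =>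
      (upperSemicontinuousOn_uscHull K P x (subset_closure hx) a ha).filter_mono
        (nhdsWithin_mono x subset_closure),
      fun x hx => (hHup x (subset_closure hx)).trans_lt (EReal.coe_lt_top _), fun x hx => ?_⟩, hHbd⟩
    exact satisfiesTestAt_uscHull hFcl (E := {w | IsSubsolution F U φ w}) hUo subset_closure
      (fun w hw => hw.sub) (fun w hw y _ => hw.le_perron y)
      (fun y _ a ha => exists_lt_of_lt_perron ha) hx
  -- The regularization is itself a member of the Perron family, hence cannot exceed the envelope.
  have hPH : ∀ x ∈ K, P x = H x := fun x hx => le_antisymm (le_uscHull hx) (hHsub.le_perron x)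
  have hmax : ∀ w, IsSubsolution F U φ w → ∀ y ∈ K, w y ≤ H y := fun w hw y hy =>
    (hw.le_perron y).trans (hPH y hy).le
  set N : M → EReal := uscHull K fun y => -H y with hN
  have hNup : ∀ y ∈ K, N y ≤ ((-m : ℝ) : EReal) := fun y _ => by
    refine uscHull_le ?_
    filter_upwards [self_mem_nhdsWithin] with z hz
    rw [EReal.coe_neg]
    exact EReal.neg_le_neg_iff.2 ((hu₀m z hz).trans (hmax u₀ hu₀ z hz))
  have hNbd : ∀ b : CornerBoundary n U, N b.pt ≤ ((-φ b : ℝ) : EReal) := fun b => by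
    refine le_of_forall_gt_imp_ge_of_dense fun a ha => ?_
    obtain ⟨r, hr, hra⟩ := EReal.lt_iff_exists_real_btwn.1 ha
    have hr' := EReal.coe_lt_coe_iff.1 hr
    obtain ⟨v, hv, hvn⟩ := hFm.exists_subsolution_near hUo hUc hU hφ hφc hconv hbdd
      b (δ := r + φ b) (by linarith)
    refine (uscHull_le ?_).trans hra.le
    filter_upwards [hvn, self_mem_nhdsWithin] with y hy hyK
    have h1 := hy.trans (hmax v hv y hyK)
    rw [show φ b - (r + φ b) = -r by ring, EReal.coe_neg] at h1
    exact EReal.neg_le.1 h1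
  have hNsub : IsSubsolution (dual F) U (fun b => -φ b) N := by
    refine ⟨upperSemicontinuousOn_uscHull K _,
      fun x hx => (hNup x hx).trans_lt (EReal.coe_lt_top _), ⟨fun x hx a ha =>
      (upperSemicontinuousOn_uscHull K _ x (subset_closure hx) a ha).filter_mono
        (nhdsWithin_mono x subset_closure),
      fun x hx => (hNup x (subset_closure hx)).trans_lt (EReal.coe_lt_top _), fun x hx => ?_⟩, hNbd⟩
    exact satisfiesTestAt_dual_of_maximal hFm hUo hHsub hmax hx
  set g : M → ℝ := fun x => (H x).toReal with hg
  have hHg : ∀ x ∈ K, H x = (g x : EReal) := fun x hx => by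
    refine (EReal.coe_toReal ?_ ?_).symm
    · exact ((hHup x hx).trans_lt (EReal.coe_lt_top _)).ne
    · exact ((EReal.bot_lt_coe m).trans_le ((hu₀m x hx).trans (hmax u₀ hu₀ x hx))).ne'
  -- Regularizing gives `N ≥ -H`; comparison of `H` with `N` gives the opposite inequality.
  have hNg : ∀ x ∈ K, N x = ((-g x : ℝ) : EReal) := fun x hx => by
    refine le_antisymm ?_ ?_
    · have h1 := hcomp.add_le_zero hUo hUc hU hHsub hNsub x hx
      rw [hHg x hx, add_comm, ← EReal.coe_zero, add_coe_le_coe_iff, zero_sub] at h1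
      exact h1
    · rw [EReal.coe_neg, ← hHg x hx]
      exact le_uscHull (f := fun y => -H y) hx
  refine ⟨g, ⟨fun x hx => ?_, hHsub.sub.congr hUo fun x hx => hHg x (subset_closure hx),
    hNsub.sub.congr hUo fun x hx => hNg x (subset_closure hx), fun b => ?_⟩,
    fun x hx => (hPH x hx).trans (hHg x hx)⟩
  -- Upper semicontinuity of `N = -g` gives the lower half of continuity, that of `H = g` the upper
  -- half.
  · refine tendsto_order.2 ⟨fun a ha => ?_, fun a ha => ?_⟩
    · have h1 : N x < ((-a : ℝ) : EReal) := by
        rw [hNg x hx, EReal.coe_lt_coe_iff]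
        linarith
      filter_upwards [hNsub.usc x hx _ h1, self_mem_nhdsWithin] with y hy hyK
      rw [hNg y hyK, EReal.coe_lt_coe_iff] at hy
      linarith
    · have h1 : H x < (a : EReal) := by
        rw [hHg x hx, EReal.coe_lt_coe_iff]
        exact ha
      filter_upwards [hHsub.usc x hx _ h1, self_mem_nhdsWithin] with y hy hyK
      rwa [hHg y hyK, EReal.coe_lt_coe_iff] at hy
  · have hb := (b.pt_mem_diff hUo).1
    have h1 := hHbd b
    have h2 := hNbd b
    rw [hHg _ hb, EReal.coe_le_coe_iff] at h1
    rw [hNg _ hb, EReal.coe_le_coe_iff] at h2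
    linarith

end Perron

end DirichletDuality

end

open DirichletDuality in
theorem theorem4p2p1 {n : ℕ} {M : Type*} [TopologicalSpace M] [T2Space M]
    [SecondCountableTopology M] [ChartedSpace (EuclideanSpace ℝ (Fin n)) M] [IsManifold (𝓡 n) ∞ M]
    (F : Set (JetBundle n M)) (hF : IsSubequation F) (hcomp : ComparisonHolds F)
    (U : Set M) (hUopen : IsOpen U) (hUconn : IsConnected U) (hUcpt : IsCompact (closure U))
    (hcorners : ClosureHasEmbeddedCorners n U)
    (hbdd : ∃ ψ : M → EReal, IsSubharmonicOn F U ψ ∧ BoundedBelowOn U ψ)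
    (hbdd_dual : ∃ ψ : M → EReal, IsSubharmonicOn (dual F) U ψ ∧ BoundedBelowOn U ψ)
    (φ : CornerBoundary n U → ℝ) (hφ : Continuous φ) (hφc : Consistent φ)
    (hconv : StrictlyConvexFor F U φ)
    (hconv_dual : StrictlyConvexFor (dual F) U (fun b => -φ b)) :
    ∃ g : M → ℝ, SolvesDirichlet F U φ g ∧
      (∀ x ∈ closure U, perron F U φ x = (g x : EReal)) ∧
      ∀ h : M → ℝ, SolvesDirichlet F U φ h → EqOn h g (closure U) := by
  obtain ⟨g, hg, hperron⟩ := exists_solvesDirichlet hF hcomp hUopen hUcpt hcorners.1 hbdd hbdd_dual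
    hφ hφc hconv hconv_dual
  -- Each solution is a subsolution and its negative a dual subsolution, so comparison applies in
  -- both orders.
  exact ⟨g, hg, hperron, fun h hh x hx => le_antisymm
    (hh.le hcomp hUopen hUcpt hcorners.1 hg hx) (hg.le hcomp hUopen hUcpt hcorners.1 hh hx)⟩
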